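/- Let $n\ge 0$ be an integer and $\mu\in\mathbb C$. Let $\Gamma_n=\langle b_1,\dots,b_n\mid b_1^2=\cdots=b_n^2=1\rangle$ and let $\Delta$ be its Cayley tree: the vertices are the elements of $\Gamma_n$, and $g,h$ are joined by an edge of colour $i$ iff $h=gb_i$. For $I\subseteq\{1,\dots,n\}$ and a vertex $v$ let $[v;I]$ be the connected component containing $v$ of the graph obtained from $\Delta$ by deleting all edges with colour outside $I$. For $i<j$ let $\mathcal A_{ij}=\{[v;\{i,j\}] : v\in\Gamma_n\}$, let $\mathcal A=\bigsqcup_{i<j}\mathcal A_{ij}$, and let $\mathcal X$ be the set of all $[v;\hat k]$, where $\hat k=\{1,\dots,n\}\setminus\{k\}$. A $\mu$-Hurwitz map is a function $\phi:\mathcal X\to\mathbb C$ such that, for every vertex $v$ and every $i$, with $x_k=\phi([v;\hat k])$, $$\phi([v;\hat i])+\phi([vb_i;\hat i])=\prod_{k\ne i}x_k\qquad\text{and}\qquad \sum_{k=1}^n x_k^2-\prod_{k=1}^n x_k=\mu .$$ For $\gamma=[v;\{i,j\}]\in\mathcal A_{ij}$ put $\phi(\gamma)=\prod_{k\ne i,j}x_k$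 and $\sigma(\gamma)=\sum_{k\neq i,j}x_k^2$; these do not depend on the choice of $v$. Let $\mathcal B_\mu$ be the set of $\mu$-Hurwitz maps $\phi$ such that $\phi(\gamma)\notin[-2,2]$ for all $\gamma\in\mathcal A$, and $\{\gamma\in\mathcal A : |\phi(\gamma)|\le K\}$ is finite for some $K>2$. (For $n\le 2$ no pair of an element of $\mathcal B_\mu$ and weights as below exists; the content is the case $n\ge3$.) Theorem. Let $\phi\in\mathcal B_\mu$ and let $q_{ij}\in\mathbb C$ $(1\le i<j\le n)$ be arbitrary with $\sum_{i<j}q_{ij}=1$. Then $\phi(\gamma)\ne0$ and $\sigma(\gamma)\neq\mu$ for every $\gamma\in\mathcal A$, and $$\sum_{1\le i<j\le n}\ \sum_{\gamma\in\mathcal A_{ij}}\left(1-\Big(1+q_{ij}\,\frac{\mu}{\sigma(\gamma)-\mu}\Big)\sqrt{1-\frac{4}{\phi(\gamma)^2}}\right)=1,$$ where the sum over each $\mathcal A_{ij}$ converges absolutely and the square root is the one with non-negative real part. -/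

import Mathlib

noncomputable section

namespace MarkoffHurwitz

/-- The group `Γ_n = ⟨b_1, …, b_n | b_1² = ⋯ = b_n² = 1⟩`,
the free product of `n` groups of order two. Colours are indexed by `Fin n`. -/
abbrev Gam (n : ℕ) : Type :=
  Monoid.CoprodI (fun _ : Fin n => Multiplicative (ZMod 2))

/-- The generating involution `b_i`. -/
def gen {n : ℕ} (i : Fin n) : Gam n :=
  Monoid.CoprodI.of (M := fun _ : Fin n => Multiplicative (ZMod 2)) (i := i)
    (Multiplicative.ofAdd 1)

theorem gen_mul_gen {n : ℕ} (i : Fin n) : gen i * gen i = 1 := by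
  have h : (Multiplicative.ofAdd (1 : ZMod 2)) * Multiplicative.ofAdd 1 = 1 := by decide
  unfold gen
  rw [← map_mul, h, map_one]

theorem gen_ne_one {n : ℕ} (i : Fin n) : gen i ≠ 1 := by
  intro h
  have h' := Monoid.CoprodI.of_injective (M := fun _ : Fin n => Multiplicative (ZMod 2)) i
    (h.trans (map_one _).symm)
  exact absurd h' (by decide)

/-- The graph on `Γ_n` whose edges are the edges of the Cayley tree `Δ` with colour in `I`:
`g` and `h` are joined by an edge of colour `i` iff `h = g * b_i`.
For `I` the set of all colours this is `Δ` itself. -/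
def colourGraph {n : ℕ} (I : Finset (Fin n)) : SimpleGraph (Gam n) where
  Adj g h := ∃ i ∈ I, h = g * gen i
  symm := by
    refine ⟨?_⟩
    rintro g h ⟨i, hi, rfl⟩
    exact ⟨i, hi, by rw [mul_assoc, gen_mul_gen, mul_one]⟩
  loopless := by
    refine ⟨?_⟩
    rintro g ⟨i, -, h⟩
    exact gen_ne_one i (mul_left_cancel (h.symm.trans (mul_one g).symm))

theorem colourGraph_mono {n : ℕ} {I J : Finset (Fin n)} (h : I ⊆ J) :
    colourGraph I ≤ colourGraph J := by
  rintro g g' ⟨i, hi, hg⟩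
  exact ⟨i, h hi, hg⟩

/-- The `I`-forest of `Δ`: the set of regular subtrees of `Δ` with colour set `I`, that is, the
connected components of what is left of `Δ` when all edges with colour outside `I` are deleted. -/
abbrev RegTree {n : ℕ} (I : Finset (Fin n)) : Type :=
  (colourGraph I).ConnectedComponent

/-- The regular subtree `[v; I]` with colour set `I` through the vertex `v`. -/
def treeAt {n : ℕ} (v : Gam n) (I : Finset (Fin n)) : RegTree I :=
  (colourGraph I).connectedComponentMk v

/-- The unique `J`-regular subtree that contains a given `I`-regular subtree, for `I ⊆ J`. -/
def RegTree.extend {n : ℕ} {I J : Finset (Fin n)} (h : I ⊆ J) (T : RegTree I) : RegTree J :=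
  SimpleGraph.ConnectedComponent.map (SimpleGraph.Hom.ofLE (colourGraph_mono h)) T

/-- A Hurwitz map: a complex-valued function on the regular subtrees of valence `n - 1`
(an element of `RegTree {i}ᶜ` is such a tree that misses exactly the colour `i`) that satisfies the
edge relation across each edge of `Δ`; the edge here has colour `i` and joins `v` to `v * b_i`. -/
structure HurwitzMap (n : ℕ) where
  val : (i : Fin n) → RegTree ({i}ᶜ : Finset (Fin n)) → ℂ
  edge_rel : ∀ (v : Gam n) (i : Fin n),
    val i (treeAt v {i}ᶜ) + val i (treeAt (v * gen i) {i}ᶜ)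
      = ∏ j ∈ ({i}ᶜ : Finset (Fin n)), val j (treeAt v {j}ᶜ)

/-- Pairs of colours `i < j`. -/
abbrev ColourPair (n : ℕ) : Type := {p : Fin n × Fin n // p.1 < p.2}

/-- The colour set `{i, j}` of a pair. -/
def ColourPair.colours {n : ℕ} (p : ColourPair n) : Finset (Fin n) := {p.1.1, p.1.2}

/-- `𝒜_{ij}`: the alternating geodesics with edges coloured `i` and `j`. -/
abbrev AltGeodesicOf {n : ℕ} (p : ColourPair n) : Type := RegTree p.colours

/-- `𝒜`: all alternating geodesics, the disjoint union of the `𝒜_{ij}`, `i < j`. -/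
abbrev AltGeodesic (n : ℕ) : Type := Σ p : ColourPair n, AltGeodesicOf p

namespace HurwitzMap

variable {n : ℕ}

theorem subset_compl_of_notMem {I : Finset (Fin n)} {k : Fin n}
    (hk : k ∉ I) : I ⊆ {k}ᶜ := by
  intro x hx
  simp only [Finset.mem_compl, Finset.mem_singleton]
  rintro rfl
  exact hk hx

/-- The value `x_k = φ(X_k)`, where `X_k ⊇ T` is the subtree of valence `n - 1` that misses
the colour `k`. -/
def coord (φ : HurwitzMap n) {I : Finset (Fin n)} (T : RegTree I) (k : {k : Fin n // k ∉ I}) : ℂ :=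
  φ.val k.1 (T.extend (subset_compl_of_notMem k.2))

/-- The extended Hurwitz map `φ(γ) = ∏_{k ≠ i, j} x_k`. -/
def ext (φ : HurwitzMap n) {p : ColourPair n} (γ : AltGeodesicOf p) : ℂ :=
  ∏ k : {k : Fin n // k ∉ p.colours}, φ.coord γ k

/-- The square sum weight `σ(γ) = ∑_{k ≠ i, j} x_k²`. -/
def sqSum (φ : HurwitzMap n) {p : ColourPair n} (γ : AltGeodesicOf p) : ℂ :=
  ∑ k : {k : Fin n // k ∉ p.colours}, φ.coord γ k ^ 2

/-- `φ` is a `μ`-Hurwitz map: the vertex relation `∑ x_i² - ∏ x_i = μ` holds at every vertex. -/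
def IsMu (φ : HurwitzMap n) (μ : ℂ) : Prop :=
  ∀ v : Gam n,
    ∑ i : Fin n, φ.val i (treeAt v {i}ᶜ) ^ 2 - ∏ i : Fin n, φ.val i (treeAt v {i}ᶜ) = μ

/-- The summand `𝔥_μ(γ, q) = 1 - (1 + q μ / (σ(γ) - μ)) √(1 - 4 / φ(γ)²)`. The principal branch
of the square root is used, so it has non-negative real part. -/
def summand (φ : HurwitzMap n) (μ q : ℂ) {p : ColourPair n} (γ : AltGeodesicOf p) : ℂ :=
  1 - (1 + q * (μ / (φ.sqSum γ - μ))) * (1 - 4 / φ.ext γ ^ 2) ^ (1 / 2 : ℂ)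

end HurwitzMap

/-- The set `ℬ_μ` of `μ`-Hurwitz maps that satisfy the Bowditch conditions
(B1) `φ(γ) ∉ [-2, 2]` for all `γ ∈ 𝒜`, and
(B2) `{γ ∈ 𝒜 : |φ(γ)| ≤ K}` is finite for some `K > 2`. -/
def Bowditch (n : ℕ) (μ : ℂ) : Set (HurwitzMap n) :=
  {φ | φ.IsMu μ ∧
    (∀ γ : AltGeodesic n, ¬ ∃ t : ℝ, t ∈ Set.Icc (-2 : ℝ) 2 ∧ φ.ext γ.2 = (t : ℂ)) ∧
    ∃ K : ℝ, 2 < K ∧ {γ : AltGeodesic n | ‖φ.ext γ.2‖ ≤ K}.Finite}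

end MarkoffHurwitz

end

/-!
Along the geodesic `γ` with colours `i`, `j` the coordinates of those colours satisfy the recurrence
`x_{m+2} = φ(γ) x_{m+1} - x_m`, so with `φ(γ) = z + 1/z` and `1 < |z|` they are of the form
`A zᵐ + B z⁻ᵐ`. The values of `φ` on the geodesics that cross `γ` are bounded away from `0`, and
then so are these coordinates; hence `A ≠ 0`, and they grow like `zᵐ`.

Direct each edge towards its endpoint with the smaller coordinate. If two edges point away from a
common vertex, then `|φ| ≤ 2` on the geodesic through them; by Kőnig's lemma all edges far from the
root therefore point towards the root, and the weights `4 / |φ(γ)|²` decay geometrically.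

Put `η(a) = (1 - √(1 - 4 / a²)) / 2`. The sum of `η(φ(γ))` over the geodesics through an edge agrees
with the flow `x_i / ∏_{k ≠ i} x_k` of the edge up to an error quadratic in the weights. Summed over
the edges between two consecutive spheres, both sides telescope, and in the limit
`∑_γ 2 η(φ(γ)) = 1 + μ ∑_v 1 / ∏_k x_k`. On the vertices of one geodesic, `∑_v 1 / ∏_k x_k`
telescopes to `√(1 - 4 / φ(γ)²) / (σ(γ) - μ)`, so the vertex sum can be distributed over each
`𝒜_{ij}`; the weights `q_{ij}` mix these ways of writing it.
-/

noncomputable section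

namespace MarkoffHurwitz

open Filter Topology

/-! ### Second order linear recurrences -/

/-- The traces `z + z⁻¹` of the loxodromic elements of `SL₂(ℂ)`: the numbers outside `[-2, 2]`. -/
def IsLoxodromic (a : ℂ) : Prop := ∀ t ∈ Set.Icc (-2 : ℝ) 2, a ≠ t

theorem exists_add_inv_eq (a : ℂ) : ∃ z : ℂ, z ≠ 0 ∧ z + z⁻¹ = a := by
  obtain ⟨s, hs⟩ := IsAlgClosed.exists_eq_mul_self (discrim 1 (-a) 1)
  obtain ⟨z, hz⟩ := exists_quadratic_eq_zero (one_ne_zero (α := ℂ)) ⟨s, hs⟩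
  have hz0 : z ≠ 0 := by
    rintro rfl
    simp at hz
  refine ⟨z, hz0, ?_⟩
  field_simp
  linear_combination hz

theorem IsLoxodromic.exists_one_lt_norm_add_inv_eq {a : ℂ} (ha : IsLoxodromic a) :
    ∃ z : ℂ, 1 < ‖z‖ ∧ z + z⁻¹ = a := by
  obtain ⟨z, hz0, hz⟩ := exists_add_inv_eq a
  rcases lt_trichotomy ‖z‖ 1 with h | h | h
  · refine ⟨z⁻¹, ?_, by rw [inv_inv, add_comm, hz]⟩
    rw [norm_inv]
    exact (one_lt_inv₀ (norm_pos_iff.2 hz0)).2 h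
  · have hre := abs_le.1 ((Complex.abs_re_le_norm z).trans h.le)
    refine absurd ?_ (ha (2 * z.re) ⟨by linarith, by linarith⟩)
    rw [← hz, Complex.inv_eq_conj h, Complex.add_conj]
  · exact ⟨z, h, hz⟩

section Recurrence

/-- The leading coefficient `A` of the solution `A zᵐ + B z⁻ᵐ` with initial values `u`, `v`. -/
def leadCoeff {𝕜 : Type*} [Field 𝕜] (z u v : 𝕜) : 𝕜 := (v - u * z⁻¹) / (z - z⁻¹)

section Field

variable {𝕜 : Type*} [Field 𝕜] {z : 𝕜} {y : ℕ → 𝕜}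

theorem leadCoeff_mul_leadCoeff (hz : z ≠ 0) (hd : z - z⁻¹ ≠ 0) (u v : 𝕜) :
    leadCoeff z u v * leadCoeff z v u * (z - z⁻¹) ^ 2 * z
      = -(u ^ 2 + v ^ 2 - (z + z⁻¹) * u * v) := by
  calc leadCoeff z u v * leadCoeff z v u * (z - z⁻¹) ^ 2 * z
      = (v - u * z⁻¹) * (u - v * z⁻¹) * z := by
        rw [leadCoeff, leadCoeff, div_mul_div_comm, ← sq, div_mul_cancel₀ _ (pow_ne_zero 2 hd)]
    _ = -(u ^ 2 + v ^ 2 - (z + z⁻¹) * u * v) := by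
        linear_combination (-v ^ 2 - u ^ 2 + u * v * z⁻¹) * mul_inv_cancel₀ hz

theorem sub_mul_inv_eq_of_recurrence (hz : z ≠ 0) (hd : z - z⁻¹ ≠ 0)
    (hy : ∀ m, y (m + 2) = (z + z⁻¹) * y (m + 1) - y m) (m : ℕ) :
    y (m + 1) - y m * z⁻¹ = leadCoeff z (y 0) (y 1) * (z - z⁻¹) * z ^ m := by
  rw [leadCoeff, div_mul_cancel₀ _ hd]
  induction m with
  | zero => simp
  | succ m ih =>
    rw [pow_succ, ← mul_assoc, ← ih, hy]
    linear_combination y m * inv_mul_cancel₀ hz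

theorem eq_of_recurrence (hz : z ≠ 0) (hd : z - z⁻¹ ≠ 0)
    (hy : ∀ m, y (m + 2) = (z + z⁻¹) * y (m + 1) - y m) (m : ℕ) :
    y m = leadCoeff z (y 0) (y 1) * z ^ m + (y 0 - leadCoeff z (y 0) (y 1)) * z⁻¹ ^ m := by
  induction m with
  | zero => simp
  | succ m ih =>
    rw [← sub_add_cancel (y (m + 1)) (y m * z⁻¹), sub_mul_inv_eq_of_recurrence hz hd hy, ih]
    ring

/-- The sum telescopes: each term is the difference of two values of `z⁻ᵐ / y m`. -/
theorem sum_range_inv_mul_succ (hz : z ≠ 0) (hd : z - z⁻¹ ≠ 0)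
    (hy : ∀ m, y (m + 2) = (z + z⁻¹) * y (m + 1) - y m) (h : leadCoeff z (y 0) (y 1) ≠ 0)
    (hne : ∀ m, y m ≠ 0) (M : ℕ) :
    ∑ m ∈ Finset.range M, (y m * y (m + 1))⁻¹
      = ((y 0)⁻¹ - z⁻¹ ^ M * (y M)⁻¹) * (leadCoeff z (y 0) (y 1) * (z - z⁻¹))⁻¹ := by
  rw [eq_mul_inv_iff_mul_eq₀ (mul_ne_zero h hd), Finset.sum_mul]
  calc _ = ∑ m ∈ Finset.range M, (z⁻¹ ^ m * (y m)⁻¹ - z⁻¹ ^ (m + 1) * (y (m + 1))⁻¹) := by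
        refine Finset.sum_congr rfl fun m _ => ?_
        have hpow : z⁻¹ ^ m * z ^ m = 1 := by rw [← mul_pow, inv_mul_cancel₀ hz, one_pow]
        have hdiff := sub_mul_inv_eq_of_recurrence hz hd hy m
        rw [inv_mul_eq_iff_eq_mul₀ (mul_ne_zero (hne m) (hne (m + 1)))]
        linear_combination (-leadCoeff z (y 0) (y 1) * (z - z⁻¹)) * hpow - z⁻¹ ^ m * hdiff
          - z⁻¹ ^ m * y (m + 1) * mul_inv_cancel₀ (hne m)
          + z⁻¹ ^ (m + 1) * y m * mul_inv_cancel₀ (hne (m + 1))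
    _ = _ := by rw [Finset.sum_range_sub' (fun m => z⁻¹ ^ m * (y m)⁻¹), pow_zero, one_mul]

end Field

section NormedField

variable {𝕜 : Type*} [NormedField 𝕜] {z : 𝕜} {y : ℕ → 𝕜}

theorem ne_zero_of_one_lt_norm (hz : 1 < ‖z‖) : z ≠ 0 :=
  norm_pos_iff.1 (one_pos.trans hz)

theorem sub_inv_ne_zero (hz : 1 < ‖z‖) : z - z⁻¹ ≠ 0 := by
  intro h
  have hinv : ‖z‖ = ‖z‖⁻¹ := by rw [← norm_inv, ← sub_eq_zero.1 h]
  linarith [inv_lt_one_of_one_lt₀ hz]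

theorem tendsto_inv_pow_zero (hz : 1 < ‖z‖) : Tendsto (fun m : ℕ => z⁻¹ ^ m) atTop (𝓝 0) :=
  tendsto_pow_atTop_nhds_zero_of_norm_lt_one (by rw [norm_inv]; exact inv_lt_one_of_one_lt₀ hz)

theorem tendsto_mul_inv_pow (hz : 1 < ‖z‖)
    (hy : ∀ m, y (m + 2) = (z + z⁻¹) * y (m + 1) - y m) :
    Tendsto (fun m => y m * z⁻¹ ^ m) atTop (𝓝 (leadCoeff z (y 0) (y 1))) := by
  have hz0 := ne_zero_of_one_lt_norm hz
  have h0 := tendsto_inv_pow_zero hz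
  have hlim := ((h0.mul h0).const_mul (y 0 - leadCoeff z (y 0) (y 1))).const_add
    (leadCoeff z (y 0) (y 1))
  simp only [mul_zero, add_zero] at hlim
  refine hlim.congr fun m => ?_
  have hpow : z⁻¹ ^ m * z ^ m = 1 := by rw [← mul_pow, inv_mul_cancel₀ hz0, one_pow]
  conv_rhs => rw [eq_of_recurrence hz0 (sub_inv_ne_zero hz) hy m]
  linear_combination -leadCoeff z (y 0) (y 1) * hpow

theorem tendsto_zero_of_leadCoeff_eq_zero (hz : 1 < ‖z‖)
    (hy : ∀ m, y (m + 2) = (z + z⁻¹) * y (m + 1) - y m) (h : leadCoeff z (y 0) (y 1) = 0) :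
    Tendsto y atTop (𝓝 0) := by
  have hlim := (tendsto_inv_pow_zero hz).const_mul (y 0)
  rw [mul_zero] at hlim
  refine hlim.congr fun m => ?_
  rw [eq_of_recurrence (ne_zero_of_one_lt_norm hz) (sub_inv_ne_zero hz) hy m, h]
  ring

theorem eventually_norm_sq_le (hz : 1 < ‖z‖)
    (hy : ∀ m, y (m + 2) = (z + z⁻¹) * y (m + 1) - y m) (h : leadCoeff z (y 0) (y 1) ≠ 0) :
    ∀ᶠ m in atTop, ‖y m‖ ^ 2 ≤ ‖z‖⁻¹ * ‖y (m + 1)‖ ^ 2 := by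
  have hp : 0 < ‖z‖ := one_pos.trans hz
  have hlim := (tendsto_mul_inv_pow hz hy).norm.pow 2
  have hlim' := (hlim.comp (tendsto_add_atTop_nat 1)).const_mul ‖z‖
  have hlt : ‖leadCoeff z (y 0) (y 1)‖ ^ 2 < ‖z‖ * ‖leadCoeff z (y 0) (y 1)‖ ^ 2 := by
    have : 0 < ‖leadCoeff z (y 0) (y 1)‖ ^ 2 := by positivity
    nlinarith
  filter_upwards [hlim.eventually_lt hlim' hlt] with m hm
  simp only [Function.comp_apply, norm_mul, norm_pow, norm_inv, mul_pow] at hm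
  refine (lt_of_mul_lt_mul_right (hm.trans_eq ?_) (by positivity : 0 ≤ (‖z‖⁻¹ ^ m) ^ 2)).le
  rw [pow_succ]
  linear_combination (‖z‖⁻¹ * ‖y (m + 1)‖ ^ 2 * (‖z‖⁻¹ ^ m) ^ 2) * mul_inv_cancel₀ hp.ne'

theorem hasSum_inv_mul_succ (hz : 1 < ‖z‖)
    (hy : ∀ m, y (m + 2) = (z + z⁻¹) * y (m + 1) - y m) (h : leadCoeff z (y 0) (y 1) ≠ 0)
    (hne : ∀ m, y m ≠ 0) (hs : Summable fun m => (y m * y (m + 1))⁻¹) :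
    HasSum (fun m => (y m * y (m + 1))⁻¹)
      (y 0 * leadCoeff z (y 0) (y 1) * (z - z⁻¹))⁻¹ := by
  have hz0 := ne_zero_of_one_lt_norm hz
  have h0 := tendsto_inv_pow_zero hz
  have htail : Tendsto (fun M => z⁻¹ ^ M * (y M)⁻¹) atTop (𝓝 0) := by
    have hlim := (h0.mul h0).mul ((tendsto_mul_inv_pow hz hy).inv₀ h)
    simp only [mul_zero, zero_mul] at hlim
    refine hlim.congr fun m => ?_
    have hpow : z⁻¹ ^ m ≠ 0 := pow_ne_zero _ (inv_ne_zero hz0)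
    rw [mul_comm (y m), mul_inv, mul_assoc, mul_inv_cancel_left₀ hpow]
  rw [hs.hasSum_iff_tendsto_nat]
  simp_rw [sum_range_inv_mul_succ hz0 (sub_inv_ne_zero hz) hy h hne]
  have hlim := (tendsto_const_nhds (x := (y 0)⁻¹)).sub htail |>.mul_const
    (leadCoeff z (y 0) (y 1) * (z - z⁻¹))⁻¹
  rwa [sub_zero, ← mul_inv, ← mul_assoc] at hlim

end NormedField

end Recurrence

/-! ### Reduced words -/

section Words

variable {ι : Type*}

/-- Words without two equal adjacent letters. The word `iₘ ⋯ i₁` stands for the vertex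
`b_{i₁} ⋯ b_{iₘ}` of the Cayley tree, so that `i :: l` is a neighbour of `l` and the root is
`[]`. -/
abbrev IsReducedWord (l : List ι) : Prop := l.IsChain (· ≠ ·)

theorem isReducedWord_cons_cons {i j : ι} {l : List ι} :
    IsReducedWord (j :: i :: l) ↔ j ≠ i ∧ IsReducedWord (i :: l) := List.isChain_cons_cons

theorem isReducedWord_cons_or_cons {j k : ι} (h : j ≠ k) {l : List ι} (hl : IsReducedWord l) :
    IsReducedWord (j :: l) ∨ IsReducedWord (k :: l) := by
  cases l with
  | nil => exact Or.inl (List.isChain_singleton j)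
  | cons g l =>
    rcases eq_or_ne j g with rfl | hg
    · exact Or.inr (isReducedWord_cons_cons.2 ⟨h.symm, hl⟩)
    · exact Or.inl (isReducedWord_cons_cons.2 ⟨hg, hl⟩)

theorem eventually_cofinite_iff_length [Finite ι] {P : List ι → Prop} :
    (∀ᶠ l in cofinite, P l) ↔ ∃ R, ∀ l : List ι, R ≤ l.length → P l := by
  rw [eventually_cofinite]
  constructor
  · intro h
    obtain ⟨R, hR⟩ := (h.image List.length).bddAbove
    refine ⟨R + 1, fun l hl => not_not.1 fun hP => ?_⟩
    have := hR ⟨l, hP, rfl⟩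
    omega
  · rintro ⟨R, hR⟩
    exact (List.finite_length_lt ι R).subset fun l hP => not_le.1 fun hl => hP (hR l hl)

theorem eventually_cofinite_of_forall_cons [Finite ι] {P : List ι → Prop}
    (h : ∀ᶠ l in cofinite, ∀ i, P (i :: l)) : ∀ᶠ l in cofinite, P l := by
  obtain ⟨R, hR⟩ := eventually_cofinite_iff_length.1 h
  refine eventually_cofinite_iff_length.2 ⟨R + 1, fun l hl => ?_⟩
  cases l with
  | nil => exact absurd hl (Nat.not_succ_le_zero R)
  | cons i l => exact hR l (Nat.le_of_succ_le_succ hl) i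

theorem eventually_forall_length_lt [Finite ι] {γ : Type*} {F : Filter γ} {R : ℕ}
    {P : γ → List ι → ι → ι → Prop}
    (hP : ∀ l i j, i ≠ j → IsReducedWord l → l.length < R → ∀ᶠ c in F, P c l i j) :
    ∀ᶠ c in F, ∀ l i j, i ≠ j → IsReducedWord l → l.length < R → P c l i j := by
  have hfin : ∀ᶠ c in F, ∀ l ∈ {l : List ι | l.length < R}, ∀ i j,
      i ≠ j → IsReducedWord l → P c l i j := by
    simp only [eventually_all_finite (List.finite_length_lt ι R), eventually_all]
    exact fun l hl i j hij hred => hP l i j hij hred hl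
  filter_upwards [hfin] with c hc l i j hij hl hlen using hc l hlen i j hij hl

/-- Kőnig's lemma for a tree of words. -/
theorem exists_path_of_infinite [Finite ι] {O : Set (List ι)} (hinf : O.Infinite)
    (htail : ∀ c l, c :: l ∈ O → l ∈ O) :
    ∃ (v : ℕ → List ι) (c : ℕ → ι),
      ∀ t, v (t + 1) = c t :: v t ∧ v t ∈ O ∧ (v t).length = t := by
  have hdrop : ∀ (m : ℕ) (l : List ι), l ∈ O → l.drop m ∈ O := by
    intro m
    induction m with
    | zero => exact fun l hl => hl
    | succ m ih =>
      rintro (_ | ⟨c, l⟩) hl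
      · exact hl
      · exact ih l (htail c l hl)
  let level (d : ℕ) : Type _ := {l : List ι // l ∈ O ∧ l.length = d}
  let π {d e : ℕ} (h : d ≤ e) (l : level e) : level d :=
    ⟨l.1.drop (e - d), hdrop _ _ l.2.1, by rw [List.length_drop, l.2.2]; omega⟩
  have hfinite (d : ℕ) : Finite (level d) :=
    ((List.finite_length_eq ι d).subset fun l hl => hl.2).to_subtype
  have hne (d : ℕ) : Nonempty (level d) := by
    obtain ⟨l, hl, hlen⟩ := hinf.exists_notMem_finite (List.finite_length_lt ι d)
    rw [Set.mem_ofPred_eq, not_lt] at hlen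
    exact ⟨⟨l.drop (l.length - d), hdrop _ _ hl, by rw [List.length_drop]; omega⟩⟩
  obtain ⟨f, hf⟩ := exists_seq_forall_proj_of_forall_finite π
    (fun _ _ => Subtype.ext (by simp [π]))
    (fun i j k hij hjk a => Subtype.ext <| by
      simp only [π, List.drop_drop]
      congr 1
      omega)
    (fun i a => Set.toFinite _)
  have hcons : ∀ t, ∃ c, (f (t + 1)).1 = c :: (f t).1 := by
    intro t
    have hproj := congrArg Subtype.val (hf (Nat.le_add_right t 1))
    have hlen := (f (t + 1)).2.2
    rcases hl : (f (t + 1)).1 with _ | ⟨c, l⟩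
    · simp [hl] at hlen
    · exact ⟨c, by simpa [π, hl] using hproj⟩
  choose c hc using hcons
  exact ⟨fun t => (f t).1, c, fun t => ⟨hc t, (f t).2⟩⟩

variable [DecidableEq ι]

/-- Strip the longest initial segment with letters in `I`: this moves a vertex to the vertex of its
regular subtree with colour set `I` that is closest to the root. -/
def strip (I : Finset ι) (l : List ι) : List ι := l.dropWhile (fun k => decide (k ∈ I))

theorem strip_cons_of_mem {I : Finset ι} {i : ι} (h : i ∈ I) (l : List ι) :
    strip I (i :: l) = strip I l := by
  simp [strip, h]

theorem strip_cons_of_notMem {I : Finset ι} {i : ι} (h : i ∉ I) (l : List ι) :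
    strip I (i :: l) = i :: l := by
  simp [strip, h]

omit [DecidableEq ι] in
/-- `l` is the vertex closest to the root of its regular subtree with colour set `I`. For nonempty
`I` this includes that `l` is reduced. -/
def IsBase (I : Finset ι) (l : List ι) : Prop := ∀ i ∈ I, IsReducedWord (i :: l)

theorem isBase_strip {I : Finset ι} {l : List ι} (h : IsReducedWord l) : IsBase I (strip I l) := by
  intro i hi
  induction l with
  | nil => exact List.isChain_singleton i
  | cons k l ih =>
    by_cases hk : k ∈ I
    · rw [strip_cons_of_mem hk]
      exact ih h.tail
    · rw [strip_cons_of_notMem hk]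
      exact isReducedWord_cons_cons.2 ⟨by rintro rfl; exact hk hi, h⟩

theorem isReducedWord_strip {I : Finset ι} {l : List ι} (h : IsReducedWord l) :
    IsReducedWord (strip I l) := h.suffix (List.dropWhile_suffix _)

theorem IsBase.strip_eq {I : Finset ι} {l : List ι} (h : IsBase I l) : strip I l = l := by
  cases l with
  | nil => rfl
  | cons k l =>
    exact strip_cons_of_notMem (fun hk => (isReducedWord_cons_cons.1 (h k hk)).1 rfl) l

theorem isBase_pair {i j : ι} {l : List ι} :
    IsBase {i, j} l ↔ IsReducedWord (i :: l) ∧ IsReducedWord (j :: l) := by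
  simp only [IsBase, Finset.mem_insert, Finset.mem_singleton, forall_eq_or_imp, forall_eq]

theorem IsBase.left {i j : ι} {l : List ι} (h : IsBase {i, j} l) : IsReducedWord (i :: l) :=
  (isBase_pair.1 h).1

theorem IsBase.right {i j : ι} {l : List ι} (h : IsBase {i, j} l) : IsReducedWord (j :: l) :=
  (isBase_pair.1 h).2

theorem IsBase.symm {i j : ι} {l : List ι} (h : IsBase {i, j} l) : IsBase {j, i} l :=
  Finset.pair_comm i j ▸ h

end Words

/-! ### Alternating words -/

section AlternatingWords

variable {ι : Type*}

/-- The letter with index `m` of the alternating word in `i`, `j`. -/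
def altColour (i j : ι) (m : ℕ) : ι := if Even m then i else j

theorem altColour_zero (i j : ι) : altColour i j 0 = i := by simp [altColour]

theorem altColour_one (i j : ι) : altColour i j 1 = j := by simp [altColour]

theorem altColour_add_two (i j : ι) (m : ℕ) : altColour i j (m + 2) = altColour i j m := by
  simp [altColour, Nat.even_add]

theorem altColour_cases (i j : ι) (m : ℕ) :
    (altColour i j m = i ∧ altColour i j (m + 1) = j) ∨
      (altColour i j m = j ∧ altColour i j (m + 1) = i) := by
  by_cases hm : Even m <;> simp [altColour, Nat.even_add_one, hm]

theorem altColour_succ_ne {i j : ι} (h : i ≠ j) (m : ℕ) :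
    altColour i j (m + 1) ≠ altColour i j m := by
  rcases altColour_cases i j m with hm | hm <;> rw [hm.1, hm.2]
  exacts [h.symm, h]

theorem pair_altColour [DecidableEq ι] (i j : ι) (m : ℕ) :
    ({altColour i j (m + 1), altColour i j m} : Finset ι) = {i, j} := by
  rcases altColour_cases i j m with hm | hm <;> rw [hm.1, hm.2]
  exact Finset.pair_comm j i

theorem altColour_mem [DecidableEq ι] (i j : ι) (m : ℕ) :
    altColour i j m ∈ ({i, j} : Finset ι) := by
  rw [← pair_altColour i j m]
  simp

/-- The word `b` preceded by the alternating word of length `m` in `i`, `j`. -/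
def altWord (i j : ι) (b : List ι) : ℕ → List ι
  | 0 => b
  | m + 1 => altColour i j m :: altWord i j b m

theorem altWord_zero (i j : ι) (b : List ι) : altWord i j b 0 = b := rfl

theorem altWord_succ (i j : ι) (b : List ι) (m : ℕ) :
    altWord i j b (m + 1) = altColour i j m :: altWord i j b m := rfl

theorem length_altWord (i j : ι) (b : List ι) (m : ℕ) :
    (altWord i j b m).length = b.length + m := by
  induction m with
  | zero => rfl
  | succ m ih => rw [altWord_succ, List.length_cons, ih, add_assoc]

theorem isReducedWord_cons_altWord {i j : ι} (h : i ≠ j) {b : List ι} (hi : IsReducedWord (i :: b))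
    (m : ℕ) : IsReducedWord (altColour i j m :: altWord i j b m) := by
  induction m with
  | zero => rwa [altColour_zero]
  | succ m ih => exact isReducedWord_cons_cons.2 ⟨altColour_succ_ne h m, ih⟩

theorem isReducedWord_altWord {i j : ι} (h : i ≠ j) {b : List ι} (hi : IsReducedWord (i :: b))
    (m : ℕ) : IsReducedWord (altWord i j b m) :=
  (isReducedWord_cons_altWord h hi m).tail

variable [DecidableEq ι]

theorem strip_altWord {i j : ι} {b : List ι} (hb : IsBase {i, j} b) (m : ℕ) :
    strip {i, j} (altWord i j b m) = b := by
  induction m with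
  | zero => exact hb.strip_eq
  | succ m ih => rw [altWord_succ, strip_cons_of_mem (altColour_mem i j m), ih]

theorem exists_cons_altWord_eq {i j k : ι} (hk : k ∈ ({i, j} : Finset ι)) {b : List ι} {m : ℕ}
    (h : IsReducedWord (k :: altWord i j b m)) :
    ∃ m', k :: altWord i j b m = altWord i j b m' ∨ k :: altWord i j b m = altWord j i b m' := by
  cases m with
  | zero =>
    rcases Finset.mem_insert.1 hk with rfl | hk
    · exact ⟨1, Or.inl (by rw [altWord_succ, altColour_zero])⟩
    · rw [Finset.mem_singleton] at hk
      subst hk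
      exact ⟨1, Or.inr (by rw [altWord_succ, altColour_zero]; rfl)⟩
  | succ m =>
    have hne := (isReducedWord_cons_cons.1 h).1
    rw [← pair_altColour i j m, Finset.mem_insert, Finset.mem_singleton] at hk
    exact ⟨m + 2, Or.inl (by rw [altWord_succ i j b (m + 1), hk.resolve_right hne])⟩

theorem exists_eq_altWord (i j : ι) {l : List ι} (h : IsReducedWord l) :
    ∃ m, l = altWord i j (strip {i, j} l) m ∨ l = altWord j i (strip {i, j} l) m := by
  induction l with
  | nil => exact ⟨0, Or.inl rfl⟩
  | cons k l ih =>
    by_cases hk : k ∈ ({i, j} : Finset ι)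
    · obtain ⟨m, hm⟩ := ih h.tail
      rw [strip_cons_of_mem hk]
      generalize strip {i, j} l = b at hm
      rcases hm with rfl | rfl
      · exact exists_cons_altWord_eq hk h
      · obtain ⟨m', hm'⟩ := exists_cons_altWord_eq (Finset.pair_comm i j ▸ hk) h
        exact ⟨m', hm'.symm⟩
    · exact ⟨0, Or.inl (by rw [strip_cons_of_notMem hk, altWord_zero])⟩

end AlternatingWords

/-! ### Hurwitz systems and their restriction to geodesics -/

section Products

variable {ι R : Type*} [Fintype ι] [DecidableEq ι]

/-- The value `∏_{k ≠ i, j} x_k` of the extended Hurwitz map on the geodesic with colours `i`, `j`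
through a vertex with coordinates `x`. -/
def pairProd [CommMonoid R] (x : ι → R) (i j : ι) : R := ∏ k ∈ ({i, j} : Finset ι)ᶜ, x k

/-- The square sum weight `∑_{k ≠ i, j} x_k²` of the geodesic with colours `i`, `j` through a vertex
with coordinates `x`. -/
def pairSq [CommSemiring R] (x : ι → R) (i j : ι) : R := ∑ k ∈ ({i, j} : Finset ι)ᶜ, x k ^ 2

/-- The product of the coordinates with colours other than `i`: the right hand side of the edge
relation. -/
def coProd [CommMonoid R] (x : ι → R) (i : ι) : R := ∏ k ∈ ({i} : Finset ι)ᶜ, x k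

theorem pairProd_comm [CommMonoid R] (x : ι → R) (i j : ι) : pairProd x i j = pairProd x j i := by
  rw [pairProd, Finset.pair_comm, pairProd]

theorem pairProd_altColour [CommMonoid R] (x : ι → R) (i j : ι) (m : ℕ) :
    pairProd x (altColour i j (m + 1)) (altColour i j m) = pairProd x i j := by
  rw [pairProd, pair_altColour, pairProd]

theorem coProd_eq_mul_pairProd [CommMonoid R] (x : ι → R) {i j : ι} (h : i ≠ j) :
    coProd x i = x j * pairProd x i j := by
  have hinsert : ({i} : Finset ι)ᶜ = insert j ({i, j} : Finset ι)ᶜ := by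
    ext k
    simp only [Finset.mem_compl, Finset.mem_insert, Finset.mem_singleton]
    grind
  rw [coProd, pairProd, hinsert, Finset.prod_insert (by simp)]

theorem prod_eq_mul_coProd [CommMonoid R] (x : ι → R) (i : ι) : ∏ k, x k = x i * coProd x i :=
  Fintype.prod_eq_mul_prod_compl i x

omit [DecidableEq ι] in
theorem exists_ne_ne (hn : 3 ≤ Fintype.card ι) (i j : ι) : ∃ k, k ≠ i ∧ k ≠ j := by
  classical
  have hne : ({i, j} : Finset ι)ᶜ.Nonempty := by
    rw [← Finset.card_pos, Finset.card_compl]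
    have := Finset.card_le_two (a := i) (b := j)
    omega
  obtain ⟨k, hk⟩ := hne
  exact ⟨k, by simpa using hk⟩

end Products

section HurwitzSystem

variable {ι : Type*} [Fintype ι] [DecidableEq ι] {μ : ℂ} {X : List ι → ι → ℂ}

/-- A `μ`-Hurwitz map in terms of its coordinates at the vertices, which are indexed by words; the
vertex `i :: l` is the neighbour of `l` along the edge of colour `i`. -/
structure HurwitzSystem (μ : ℂ) (X : List ι → ι → ℂ) : Prop where
  of_ne : ∀ l i k, k ≠ i → X (i :: l) k = X l k
  edge : ∀ l i, X l i + X (i :: l) i = coProd (X l) i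
  vertex : ∀ l, ∑ k, X l k ^ 2 - ∏ k, X l k = μ

/-- A `μ`-Hurwitz map that satisfies the Bowditch conditions, in terms of its coordinates. The
geodesics are indexed by their vertices closest to the root in `exists_bound`. -/
structure BowditchSystem (μ : ℂ) (X : List ι → ι → ℂ) : Prop extends HurwitzSystem μ X where
  three_le : 3 ≤ Fintype.card ι
  isLoxodromic_pairProd : ∀ l i j, i ≠ j → IsLoxodromic (pairProd (X l) i j)
  exists_bound : ∃ K : ℝ, 2 < K ∧ ∀ᶠ l in cofinite, ∀ i j, i ≠ j → IsBase {i, j} l →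
    K < ‖pairProd (X l) i j‖

/-- The coordinates of the endpoints of the edges along an alternating geodesic: `X` at the vertex
number `m`, at the colour of the edge from there to the vertex number `m + 1`. -/
def geodesicSeq (X : List ι → ι → ℂ) (i j : ι) (b : List ι) (m : ℕ) : ℂ :=
  X (altWord i j b m) (altColour i j m)

omit [Fintype ι] [DecidableEq ι] in
theorem geodesicSeq_zero (i j : ι) (b : List ι) : geodesicSeq X i j b 0 = X b i := by
  rw [geodesicSeq, altWord_zero, altColour_zero]

namespace HurwitzSystem

variable (S : HurwitzSystem μ X)

include S

theorem apply_strip {I : Finset ι} {k : ι} (hk : k ∉ I) (l : List ι) :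
    X (strip I l) k = X l k := by
  induction l with
  | nil => rfl
  | cons i l ih =>
    by_cases hi : i ∈ I
    · rw [strip_cons_of_mem hi, ih, S.of_ne _ _ _ (ne_of_mem_of_not_mem hi hk).symm]
    · rw [strip_cons_of_notMem hi]

theorem pairProd_strip (i j : ι) (l : List ι) :
    pairProd (X (strip {i, j} l)) i j = pairProd (X l) i j :=
  Finset.prod_congr rfl fun _ hk => S.apply_strip (Finset.mem_compl.1 hk) l

theorem pairSq_strip (i j : ι) (l : List ι) :
    pairSq (X (strip {i, j} l)) i j = pairSq (X l) i j :=
  Finset.sum_congr rfl fun k hk => by rw [S.apply_strip (Finset.mem_compl.1 hk) l]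

theorem pairProd_cons (i j : ι) (l : List ι) :
    pairProd (X (i :: l)) i j = pairProd (X l) i j := by
  rw [← S.pairProd_strip i j (i :: l), strip_cons_of_mem (Finset.mem_insert_self i _),
    S.pairProd_strip]

theorem coProd_cons (i : ι) (l : List ι) : coProd (X (i :: l)) i = coProd (X l) i :=
  Finset.prod_congr rfl fun k hk => S.of_ne _ _ _ (by simpa using hk)

theorem vertex_pair {i j : ι} (h : i ≠ j) (l : List ι) :
    X l i ^ 2 + X l j ^ 2 - pairProd (X l) i j * X l i * X l j = μ - pairSq (X l) i j := by
  have hv := S.vertex l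
  rw [prod_eq_mul_coProd (X l) i, coProd_eq_mul_pairProd (X l) h,
    ← Finset.sum_add_sum_compl ({i, j} : Finset ι), Finset.sum_pair h] at hv
  rw [pairSq]
  linear_combination hv

theorem apply_altWord_of_notMem {i j k : ι} (hk : k ∉ ({i, j} : Finset ι)) (b : List ι) (m : ℕ) :
    X (altWord i j b m) k = X b k := by
  induction m with
  | zero => rfl
  | succ m ih =>
    rw [altWord_succ, S.of_ne _ _ _ (ne_of_mem_of_not_mem (altColour_mem i j m) hk).symm, ih]

theorem pairProd_altWord (i j : ι) (b : List ι) (m : ℕ) :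
    pairProd (X (altWord i j b m)) i j = pairProd (X b) i j :=
  Finset.prod_congr rfl fun _ hk => S.apply_altWord_of_notMem (Finset.mem_compl.1 hk) b m

theorem apply_altWord_succ {i j : ι} (h : i ≠ j) (b : List ι) (m : ℕ) :
    X (altWord i j b m) (altColour i j (m + 1)) = geodesicSeq X i j b (m + 1) := by
  rw [geodesicSeq, altWord_succ, S.of_ne _ _ _ (altColour_succ_ne h m)]

theorem geodesicSeq_one {i j : ι} (h : i ≠ j) (b : List ι) : geodesicSeq X i j b 1 = X b j := by
  rw [← S.apply_altWord_succ h b 0, altWord_zero, altColour_one]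

theorem coProd_altWord {i j : ι} (h : i ≠ j) (b : List ι) (m : ℕ) :
    coProd (X (altWord i j b m)) (altColour i j m)
      = pairProd (X b) i j * geodesicSeq X i j b (m + 1) := by
  rw [coProd_eq_mul_pairProd _ (altColour_succ_ne h m).symm, pairProd_comm, pairProd_altColour,
    S.pairProd_altWord, S.apply_altWord_succ h, mul_comm]

theorem geodesicSeq_recurrence {i j : ι} (h : i ≠ j) (b : List ι) (m : ℕ) :
    geodesicSeq X i j b (m + 2)
      = pairProd (X b) i j * geodesicSeq X i j b (m + 1) - geodesicSeq X i j b m := by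
  rw [← S.coProd_altWord h, ← S.edge, ← S.apply_altWord_succ h, altColour_add_two, altWord_succ]
  exact (add_sub_cancel_left _ _).symm

end HurwitzSystem

namespace BowditchSystem

variable (S : BowditchSystem μ X)

include S

theorem pairProd_ne_zero {i j : ι} (h : i ≠ j) (l : List ι) : pairProd (X l) i j ≠ 0 := by
  simpa using S.isLoxodromic_pairProd l i j h 0 (by norm_num)

theorem ne_zero (l : List ι) (k : ι) : X l k ≠ 0 := by
  obtain ⟨i, hi, -⟩ := exists_ne_ne S.three_le k k
  obtain ⟨j, hj, hji⟩ := exists_ne_ne S.three_le k i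
  intro h
  exact S.pairProd_ne_zero hji l (Finset.prod_eq_zero (by simp [hi.symm, hj.symm]) h)

theorem coProd_ne_zero (l : List ι) (k : ι) : coProd (X l) k ≠ 0 :=
  Finset.prod_ne_zero_iff.2 fun i _ => S.ne_zero l i

theorem exists_le_norm_pairProd :
    ∃ ε > 0, ∀ l i j, i ≠ j → IsReducedWord l → ε ≤ ‖pairProd (X l) i j‖ := by
  obtain ⟨K, hK, h⟩ := S.exists_bound
  obtain ⟨R, hR⟩ := eventually_cofinite_iff_length.1 h
  have hshort : ∀ᶠ ε in 𝓝[>] (0 : ℝ), ∀ l i j, i ≠ j → IsReducedWord l → l.length < R →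
      ε ≤ ‖pairProd (X l) i j‖ := by
    refine eventually_forall_length_lt fun l i j hij _ _ => ?_
    filter_upwards [Ioo_mem_nhdsGT (norm_pos_iff.2 (S.pairProd_ne_zero hij l))] with ε hε
      using hε.2.le
  have hlt : ∀ᶠ ε in 𝓝[>] (0 : ℝ), ε ∈ Set.Ioo (0 : ℝ) K := Ioo_mem_nhdsGT (by linarith)
  obtain ⟨ε, hε, h0, hεK⟩ := (hshort.and hlt).exists
  refine ⟨ε, h0, fun l i j hij hl => ?_⟩
  rw [← S.pairProd_strip]
  by_cases hb : R ≤ (strip {i, j} l).length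
  · exact hεK.le.trans (hR _ hb i j hij (isBase_strip hl)).le
  · exact hε _ i j hij (isReducedWord_strip hl) (not_le.1 hb)

theorem exists_le_norm_geodesicSeq {i j : ι} (hij : i ≠ j) {b : List ι}
    (hi : IsReducedWord (i :: b)) : ∃ δ > 0, ∀ m, δ ≤ ‖geodesicSeq X i j b (m + 1)‖ := by
  obtain ⟨k, hki, hkj⟩ := exists_ne_ne S.three_le i j
  have hk : k ∉ ({i, j} : Finset ι) := by simp [hki, hkj]
  obtain ⟨ε, hε, hlow⟩ := S.exists_le_norm_pairProd
  have hP := norm_pos_iff.2 (S.pairProd_ne_zero hij b)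
  have hX := norm_pos_iff.2 (S.ne_zero b k)
  refine ⟨‖X b k‖ * ε / ‖pairProd (X b) i j‖, by positivity, fun m => ?_⟩
  have hmk := ne_of_mem_of_not_mem (altColour_mem i j m) hk
  rw [div_le_iff₀' hP, ← norm_mul, ← S.coProd_altWord hij, coProd_eq_mul_pairProd _ hmk,
    S.apply_altWord_of_notMem hk, norm_mul]
  exact mul_le_mul_of_nonneg_left (hlow _ _ _ hmk (isReducedWord_altWord hij hi m)) hX.le

theorem leadCoeff_ne_zero_of_isReducedWord_cons {i j : ι} (hij : i ≠ j) {b : List ι}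
    (hi : IsReducedWord (i :: b)) {z : ℂ} (hz : 1 < ‖z‖) (hzP : z + z⁻¹ = pairProd (X b) i j) :
    leadCoeff z (X b i) (X b j) ≠ 0 := by
  intro h0
  obtain ⟨δ, hδ, hlow⟩ := S.exists_le_norm_geodesicSeq hij hi
  have hlim := tendsto_zero_of_leadCoeff_eq_zero (y := geodesicSeq X i j b) hz
    (hzP ▸ S.geodesicSeq_recurrence hij b)
    (by rw [geodesicSeq_zero, S.geodesicSeq_one hij, h0])
  have hle := ge_of_tendsto' (hlim.comp (tendsto_add_atTop_nat 1)).norm hlow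
  rw [norm_zero] at hle
  exact hδ.not_ge hle

/-- If `σ = μ`, the vertex relation says that one of the two leading coefficients of the
coordinates along the geodesic vanishes. -/
theorem pairSq_ne {i j : ι} (hij : i ≠ j) {l : List ι} (hl : IsReducedWord l) :
    pairSq (X l) i j ≠ μ := by
  rw [← S.pairSq_strip]
  have hb : IsBase {i, j} (strip {i, j} l) := isBase_strip hl
  generalize strip {i, j} l = b at hb
  intro h
  obtain ⟨z, hz, hzP⟩ := (S.isLoxodromic_pairProd b i j hij).exists_one_lt_norm_add_inv_eq
  have hz0 := ne_zero_of_one_lt_norm hz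
  have hd := sub_inv_ne_zero hz
  have hprod := leadCoeff_mul_leadCoeff hz0 hd (X b i) (X b j)
  rw [hzP, S.vertex_pair hij, h, sub_self, neg_zero] at hprod
  have hij0 := S.leadCoeff_ne_zero_of_isReducedWord_cons hij hb.left hz hzP
  have hji0 := S.leadCoeff_ne_zero_of_isReducedWord_cons hij.symm hb.right hz
    (by rw [hzP, pairProd_comm])
  exact mul_ne_zero (mul_ne_zero (mul_ne_zero hij0 hji0) (pow_ne_zero 2 hd)) hz0 hprod

theorem leadCoeff_ne_zero {i j : ι} (hij : i ≠ j) {l : List ι} (hl : IsReducedWord l) {z : ℂ}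
    (hz : 1 < ‖z‖) (hzP : z + z⁻¹ = pairProd (X l) i j) :
    leadCoeff z (X l i) (X l j) ≠ 0 := by
  intro h
  have hprod := leadCoeff_mul_leadCoeff (ne_zero_of_one_lt_norm hz) (sub_inv_ne_zero hz)
    (X l i) (X l j)
  rw [hzP, S.vertex_pair hij, h] at hprod
  exact S.pairSq_ne hij hl (by linear_combination -hprod)

end BowditchSystem

end HurwitzSystem

/-! ### Growth along geodesics -/

section Growth

variable {ι : Type*} {μ : ℂ} {X : List ι → ι → ℂ}

/-- The factor by which the weight `4 / |φ(γ)|²` changes from the geodesic with colours `i`, `k`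
through `l` to the geodesic with colours `j`, `k` through `i :: l`. -/
def turnRatio (X : List ι → ι → ℂ) (l : List ι) (i j : ι) : ℝ :=
  ‖X l j‖ ^ 2 / ‖X (i :: l) i‖ ^ 2

theorem turnRatio_nonneg (X : List ι → ι → ℂ) (l : List ι) (i j : ι) : 0 ≤ turnRatio X l i j := by
  unfold turnRatio
  positivity

/-- The behaviour of the coordinates across an edge from `l` to `i :: l` that is far out on the
geodesic with colours `i`, `j`: the new coordinate dominates the two old ones. -/
structure GeodesicGrowth (X : List ι → ι → ℂ) (s : ℝ) (l : List ι) (i j : ι) : Prop where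
  turnRatio_le : turnRatio X l i j ≤ s
  norm_lt : ‖X l i‖ < ‖X (i :: l) i‖

theorem GeodesicGrowth.mono {s s' : ℝ} {l : List ι} {i j : ι} (h : GeodesicGrowth X s l i j)
    (hs : s ≤ s') : GeodesicGrowth X s' l i j :=
  ⟨h.turnRatio_le.trans hs, h.norm_lt⟩

namespace BowditchSystem

variable [Fintype ι] [DecidableEq ι] (S : BowditchSystem μ X)

include S

theorem eventually_geodesicGrowth_altWord {i j : ι} (hij : i ≠ j) {b : List ι}
    (hb : IsReducedWord b) {z : ℂ} (hz : 1 < ‖z‖) (hzP : z + z⁻¹ = pairProd (X b) i j) :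
    ∀ᶠ m in atTop,
      GeodesicGrowth X ‖z‖⁻¹ (altWord i j b m) (altColour i j m) (altColour i j (m + 1)) := by
  have hrec : ∀ m, geodesicSeq X i j b (m + 2)
      = (z + z⁻¹) * geodesicSeq X i j b (m + 1) - geodesicSeq X i j b m :=
    hzP ▸ S.geodesicSeq_recurrence hij b
  have hlead : leadCoeff z (geodesicSeq X i j b 0) (geodesicSeq X i j b 1) ≠ 0 := by
    rw [geodesicSeq_zero, S.geodesicSeq_one hij]
    exact S.leadCoeff_ne_zero hij hb hz hzP
  have hratio := eventually_norm_sq_le hz hrec hlead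
  filter_upwards [hratio, (tendsto_add_atTop_nat 1).eventually hratio] with m h0 h1
  have hnew : X (altColour i j m :: altWord i j b m) (altColour i j m)
      = geodesicSeq X i j b (m + 2) := by
    rw [geodesicSeq, altColour_add_two, ← altWord_succ, altWord_succ i j b (m + 1),
      S.of_ne _ _ _ (altColour_succ_ne hij m).symm]
  have hpos : 0 < ‖geodesicSeq X i j b (m + 2)‖ ^ 2 := pow_pos (norm_pos_iff.2 (S.ne_zero _ _)) 2
  constructor
  · rw [turnRatio, hnew, S.apply_altWord_succ hij, div_le_iff₀ hpos]
    exact h1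
  · rw [hnew]
    refine lt_of_pow_lt_pow_left₀ 2 (norm_nonneg _) ?_
    have hinv : ‖z‖⁻¹ < 1 := inv_lt_one_of_one_lt₀ hz
    calc ‖geodesicSeq X i j b m‖ ^ 2 ≤ 1 * ‖geodesicSeq X i j b (m + 1)‖ ^ 2 :=
          h0.trans (by gcongr)
      _ ≤ ‖z‖⁻¹ * ‖geodesicSeq X i j b (m + 2)‖ ^ 2 := by rw [one_mul]; exact h1
      _ < ‖geodesicSeq X i j b (m + 2)‖ ^ 2 := mul_lt_of_lt_one_left hpos hinv

theorem exists_geodesicGrowth {i j : ι} (hij : i ≠ j) {b : List ι} (hb : IsReducedWord b) :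
    ∃ s < (1 : ℝ), ∀ᶠ l in cofinite, IsReducedWord (i :: l) → strip {i, j} l = b →
      GeodesicGrowth X s l i j := by
  obtain ⟨z, hz, hzP⟩ := (S.isLoxodromic_pairProd b i j hij).exists_one_lt_norm_add_inv_eq
  refine ⟨‖z‖⁻¹, inv_lt_one_of_one_lt₀ hz, ?_⟩
  obtain ⟨M, hM⟩ := eventually_atTop.1 <|
    (S.eventually_geodesicGrowth_altWord hij hb hz hzP).and
    (S.eventually_geodesicGrowth_altWord hij.symm hb hz (by rw [hzP, pairProd_comm]))
  refine eventually_cofinite_iff_length.2 ⟨b.length + M, fun l hl hred hst => ?_⟩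
  have hst' : strip {i, j} (i :: l) = b := by
    rw [strip_cons_of_mem (Finset.mem_insert_self i _), hst]
  obtain ⟨m', hm'⟩ := exists_eq_altWord i j hred
  rw [hst'] at hm'
  have hlen : i :: l = altWord i j b m' ∨ i :: l = altWord j i b m' →
      l.length + 1 = b.length + m' := by
    rintro (h | h) <;> rw [← List.length_cons, h, length_altWord]
  obtain ⟨m, rfl⟩ : ∃ m, m' = m + 1 := ⟨m' - 1, by have := hlen hm'; omega⟩
  have hMm : M ≤ m := by have := hlen hm'; omega
  rcases hm' with h | h
  · obtain ⟨hi, rfl⟩ := List.cons.inj h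
    have hj : altColour i j (m + 1) = j := by
      rcases altColour_cases i j m with hc | hc
      exacts [hc.2, absurd (hi.trans hc.1) hij]
    simpa only [← hi, hj] using (hM m hMm).1
  · obtain ⟨hi, rfl⟩ := List.cons.inj h
    have hj : altColour j i (m + 1) = j := by
      rcases altColour_cases j i m with hc | hc
      exacts [absurd (hi.trans hc.1) hij, hc.2]
    simpa only [← hi, hj] using (hM m hMm).2

/-- Only finitely many geodesics carry a value of norm at most `K`, so the growth is uniform. -/
theorem exists_geodesicGrowth_of_norm_le {K : ℝ}
    (hK : ∀ᶠ l in cofinite, ∀ i j, i ≠ j → IsBase {i, j} l → K < ‖pairProd (X l) i j‖) :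
    ∃ s < (1 : ℝ), ∀ᶠ l in cofinite, ∀ i j, i ≠ j → IsReducedWord (i :: l) →
      ‖pairProd (X l) i j‖ ≤ K → GeodesicGrowth X s l i j := by
  obtain ⟨R, hR⟩ := eventually_cofinite_iff_length.1 hK
  have huniform : ∀ᶠ s in 𝓝[<] (1 : ℝ), ∀ b i j, i ≠ j → IsReducedWord b → b.length < R →
      ∀ᶠ l in cofinite, IsReducedWord (i :: l) → strip {i, j} l = b →
        GeodesicGrowth X s l i j := by
    refine eventually_forall_length_lt fun b i j hij hb _ => ?_
    obtain ⟨s, hs, h⟩ := S.exists_geodesicGrowth hij hb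
    filter_upwards [Ioo_mem_nhdsLT hs] with s' hs'
    filter_upwards [h] with l hl hred hst using (hl hred hst).mono hs'.1.le
  obtain ⟨s, hs, hs1⟩ := (huniform.and eventually_mem_nhdsWithin).exists
  refine ⟨s, hs1, ?_⟩
  have hlong : ∀ᶠ l in cofinite, ∀ b i j, i ≠ j → IsReducedWord b → b.length < R →
      IsReducedWord (i :: l) → strip {i, j} l = b → GeodesicGrowth X s l i j :=
    eventually_forall_length_lt hs
  filter_upwards [hlong] with l hl i j hij hred hle
  have hlen : (strip {i, j} l).length < R := by
    by_contra! hlen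
    have hlt := hR _ hlen i j hij (isBase_strip hred.tail)
    rw [S.pairProd_strip] at hlt
    exact hlt.not_ge hle
  exact hl _ i j hij (isReducedWord_strip hred.tail) hlen hred rfl

end BowditchSystem

end Growth

/-! ### Far from the root, all edges point towards the root -/

section Outward

variable {ι : Type*} {μ : ℂ} {X : List ι → ι → ℂ}

/-- The edge from `l` to `i :: l` points away from the root: an edge is directed towards its
endpoint with the smaller coordinate. -/
def IsOutward (X : List ι → ι → ℂ) (l : List ι) (i : ι) : Prop := ‖X (i :: l) i‖ < ‖X l i‖

variable [Fintype ι] [DecidableEq ι]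

theorem HurwitzSystem.norm_pairProd_mul_le (S : HurwitzSystem μ X) {i j : ι} (hij : i ≠ j)
    (l : List ι) :
    ‖pairProd (X l) i j‖ * ‖X l j‖ ≤ ‖X l i‖ + ‖X (i :: l) i‖ := by
  rw [mul_comm, ← norm_mul, ← coProd_eq_mul_pairProd _ hij, ← S.edge]
  exact norm_add_le _ _

theorem HurwitzSystem.norm_pairProd_mul_cons_le (S : HurwitzSystem μ X) {i j : ι} (hij : i ≠ j)
    (l : List ι) :
    ‖pairProd (X (i :: l)) i j‖ * ‖X (i :: l) j‖ ≤ ‖X l i‖ + ‖X (i :: l) i‖ := by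
  rw [S.pairProd_cons, S.of_ne _ _ _ hij.symm]
  exact S.norm_pairProd_mul_le hij l

namespace BowditchSystem

variable (S : BowditchSystem μ X)

include S

theorem norm_pairProd_le_two_of_isOutward {i j : ι} (hij : i ≠ j) {l : List ι}
    (hi : ¬ IsOutward X l i) (hj : IsOutward X (i :: l) j) :
    ‖pairProd (X (i :: l)) i j‖ ≤ 2 := by
  have h1 := S.norm_pairProd_mul_cons_le hij l
  have h2 := S.norm_pairProd_mul_le hij.symm (i :: l)
  rw [pairProd_comm] at h2
  have hi' : ‖X l i‖ ≤ ‖X (i :: l) i‖ := not_lt.1 hi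
  have hj' : ‖X (j :: i :: l) j‖ < ‖X (i :: l) j‖ := hj
  have hpos := norm_pos_iff.2 (S.ne_zero (i :: l) j)
  by_contra! hp
  have h3 := mul_lt_mul_of_pos_right hp hpos
  have h4 := mul_le_mul_of_nonneg_right hp.le (norm_nonneg (X (i :: l) i))
  linarith

theorem norm_pairProd_sq_mul_le_of_isOutward {i j : ι} (hij : i ≠ j) {l : List ι}
    (hi : IsOutward X l i) (hj : IsOutward X (i :: l) j) :
    ‖pairProd (X (i :: l)) i j‖ ^ 2 * ‖X (i :: l) i‖ ≤ 4 * ‖X l i‖ := by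
  have h1 := S.norm_pairProd_mul_cons_le hij l
  have h2 := S.norm_pairProd_mul_le hij.symm (i :: l)
  rw [pairProd_comm] at h2
  have hi' : ‖X (i :: l) i‖ < ‖X l i‖ := hi
  have hj' : ‖X (j :: i :: l) j‖ < ‖X (i :: l) j‖ := hj
  calc ‖pairProd (X (i :: l)) i j‖ ^ 2 * ‖X (i :: l) i‖
      = ‖pairProd (X (i :: l)) i j‖ * (‖pairProd (X (i :: l)) i j‖ * ‖X (i :: l) i‖) := by ring
    _ ≤ ‖pairProd (X (i :: l)) i j‖ * (2 * ‖X (i :: l) j‖) :=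
        mul_le_mul_of_nonneg_left (by linarith) (norm_nonneg _)
    _ ≤ 4 * ‖X l i‖ := by linarith

theorem exists_norm_pairProd_gt_of_isOutward :
    ∃ K : ℝ, 2 < K ∧ ∀ᶠ l in cofinite, ∀ i j, i ≠ j → IsReducedWord (i :: l) →
      IsOutward X l i → K < ‖pairProd (X l) i j‖ := by
  obtain ⟨K, hK, hbound⟩ := S.exists_bound
  obtain ⟨s, -, hs⟩ := S.exists_geodesicGrowth_of_norm_le hbound
  refine ⟨K, hK, ?_⟩
  filter_upwards [hs] with l hl i j hij hred hout
  by_contra! hle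
  exact hout.not_gt (hl i j hij hred hle).norm_lt

section Path

variable {v : ℕ → List ι} {c : ℕ → ι} (hv : ∀ t, v (t + 1) = c t :: v t)

include hv

theorem exists_tendsto_norm_of_isOutward (hred : ∀ t, IsReducedWord (v t))
    (hout : ∀ᶠ t in atTop, IsOutward X (v t) (c t)) :
    ∃ L : ι → ℝ, ∀ k, 0 < L k ∧ Tendsto (fun t => ‖X (v t) k‖) atTop (𝓝 (L k)) := by
  obtain ⟨T, hT⟩ := eventually_atTop.1 hout
  have hlim : ∀ k, ∃ L, Tendsto (fun t => ‖X (v t) k‖) atTop (𝓝 L) := by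
    intro k
    have hanti : Antitone fun t => ‖X (v (t + T)) k‖ := by
      refine antitone_nat_of_succ_le fun t => ?_
      rw [add_right_comm, hv]
      rcases eq_or_ne k (c (t + T)) with rfl | hk
      · exact (hT _ (Nat.le_add_left T t)).le
      · rw [S.of_ne _ _ _ hk]
    have hbdd : BddBelow (Set.range fun t => ‖X (v (t + T)) k‖) :=
      ⟨0, Set.forall_mem_range.2 fun t => norm_nonneg _⟩
    exact ⟨_, (tendsto_add_atTop_iff_nat T).1 (tendsto_atTop_ciInf hanti hbdd)⟩
  choose L hL using hlim
  refine ⟨L, fun k => ⟨?_, hL k⟩⟩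
  refine (ge_of_tendsto' (hL k) fun t => norm_nonneg _).lt_of_ne' fun hk => ?_
  obtain ⟨i, hi, -⟩ := exists_ne_ne S.three_le k k
  obtain ⟨j, hj, hji⟩ := exists_ne_ne S.three_le k i
  obtain ⟨ε, hε, hlow⟩ := S.exists_le_norm_pairProd
  have hprod : Tendsto (fun t => ‖pairProd (X (v t)) i j‖) atTop (𝓝 (pairProd L i j)) := by
    simp only [pairProd, norm_prod]
    exact tendsto_finsetProd _ fun m _ => hL m
  have hle := ge_of_tendsto' hprod fun t => hlow (v t) i j hji.symm (hred t)
  rw [pairProd, Finset.prod_eq_zero (i := k) (by simp [hi.symm, hj.symm]) hk] at hle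
  exact hε.not_ge hle

/-- Along such a path the coordinates would converge to positive limits, while two consecutive
outward edges force a coordinate to decrease by a definite factor. -/
theorem not_eventually_isOutward (hred : ∀ t, IsReducedWord (v t)) :
    ¬ ∀ᶠ t in atTop, IsOutward X (v t) (c t) := by
  intro hout
  have hlen : ∀ t, (v t).length = (v 0).length + t := by
    intro t
    induction t with
    | zero => rfl
    | succ t ih => rw [hv, List.length_cons, ih, add_assoc]
  have hinj : Function.Injective v := fun s t h => by
    have := congrArg List.length h
    rwa [hlen, hlen t, Nat.add_left_cancel_iff] at this
  have hcof : Tendsto v atTop cofinite := Nat.cofinite_eq_atTop ▸ hinj.tendsto_cofinite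
  obtain ⟨K, hK, hbig⟩ := S.exists_norm_pairProd_gt_of_isOutward
  obtain ⟨L, hL⟩ := S.exists_tendsto_norm_of_isOutward hv hred hout
  have hslow : ∀ᶠ t in atTop, ∀ k, 4 * ‖X (v t) k‖ < K ^ 2 * ‖X (v (t + 1)) k‖ := by
    refine eventually_all.2 fun k => ((hL k).2.const_mul 4).eventually_lt
      (((hL k).2.comp (tendsto_add_atTop_nat 1)).const_mul (K ^ 2)) ?_
    exact mul_lt_mul_of_pos_right (by nlinarith) (hL k).1
  have hshift := tendsto_add_atTop_nat 1
  obtain ⟨t, ht, hout0, hout1, hbig1⟩ := (hslow.and (hout.and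
    ((hshift.eventually hout).and (hshift.eventually (hcof.eventually hbig))))).exists
  have hword : IsReducedWord (c (t + 1) :: c t :: v t) := by
    rw [← hv, ← hv]
    exact hred _
  have hne := (isReducedWord_cons_cons.1 hword).1
  rw [hv] at hout1 hbig1 ht
  have hdec := S.norm_pairProd_sq_mul_le_of_isOutward hne.symm hout0 hout1
  have hpair := hbig1 _ _ hne hword hout1
  rw [pairProd_comm] at hpair
  have hsq : K ^ 2 * ‖X (c t :: v t) (c t)‖
      ≤ ‖pairProd (X (c t :: v t)) (c t) (c (t + 1))‖ ^ 2 * ‖X (c t :: v t) (c t)‖ := by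
    gcongr
  linarith [ht (c t)]

end Path

theorem eventually_not_isOutward :
    ∀ᶠ l in cofinite, ∀ i, IsReducedWord (i :: l) → ¬ IsOutward X l i := by
  obtain ⟨K, hK, hbig⟩ := S.exists_norm_pairProd_gt_of_isOutward
  obtain ⟨R, hR⟩ := eventually_cofinite_iff_length.1 hbig
  set O : Set (List ι) := {l | IsReducedWord l ∧ (l.length ≤ R + 1 ∨
    ∃ i l', l = i :: l' ∧ IsOutward X l' i)}
  have htail : ∀ j l, j :: l ∈ O → l ∈ O := by
    rintro j l ⟨hred, hor⟩
    refine ⟨hred.tail, or_iff_not_imp_left.2 fun hlen => ?_⟩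
    rcases hor with hor | ⟨_, _, heq, hj⟩
    · exact absurd (Nat.le_of_succ_le hor) hlen
    obtain ⟨rfl, rfl⟩ := List.cons.inj heq
    obtain ⟨i, l, rfl⟩ := List.exists_cons_of_ne_nil (l := l) (by rintro rfl; simp at hlen)
    have hij := (isReducedWord_cons_cons.1 hred).1
    refine ⟨i, l, rfl, of_not_not fun hi => ?_⟩
    have hle := S.norm_pairProd_le_two_of_isOutward hij.symm hi hj
    have hlt := hR (i :: l) (by omega) j i hij hred hj
    rw [pairProd_comm] at hlt
    linarith
  have hfin : O.Finite := by
    by_contra hinf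
    obtain ⟨v, c, hv⟩ := exists_path_of_infinite hinf htail
    refine S.not_eventually_isOutward (fun t => (hv t).1) (fun t => (hv t).2.1.1) ?_
    filter_upwards [eventually_ge_atTop (R + 1)] with t ht
    rcases (hv (t + 1)).2.1.2 with hlen | ⟨i, l, heq, hi⟩
    · rw [(hv (t + 1)).2.2] at hlen
      omega
    · rw [(hv t).1] at heq
      obtain ⟨rfl, rfl⟩ := List.cons.inj heq
      exact hi
  have hcons : ∀ᶠ l in cofinite, ∀ i, i :: l ∉ O := eventually_all.2 fun i =>
    List.cons_injective.tendsto_cofinite.eventually hfin.compl_mem_cofinite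
  filter_upwards [hcons] with l hl i hred hi using hl i ⟨hred, Or.inr ⟨i, l, rfl, hi⟩⟩

end BowditchSystem

end Outward

/-! ### The summand of the identity for `q = 0` -/

section Eta

theorem re_pos_of_norm_one_sub_lt {w : ℂ} (h : ‖1 - w‖ < ‖1 + w‖) : 0 < w.re := by
  have hsq := pow_lt_pow_left₀ h (norm_nonneg _) two_ne_zero
  rw [← Complex.normSq_eq_norm_sq, ← Complex.normSq_eq_norm_sq, Complex.normSq_sub,
    Complex.normSq_add] at hsq
  simp only [Complex.normSq_one, one_mul, Complex.conj_re] at hsq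
  linarith

theorem add_inv_ne_zero {z : ℂ} (hz : 1 < ‖z‖) : z + z⁻¹ ≠ 0 := by
  intro h
  have hnorm := congrArg norm (eq_neg_of_add_eq_zero_left h)
  rw [norm_neg, norm_inv] at hnorm
  exact ((inv_lt_one_of_one_lt₀ hz).trans hz).ne' hnorm

theorem re_sub_inv_div_add_inv_pos {z : ℂ} (hz : 1 < ‖z‖) : 0 < ((z - z⁻¹) / (z + z⁻¹)).re := by
  have hd := add_inv_ne_zero hz
  apply re_pos_of_norm_one_sub_lt
  rw [one_sub_div hd, one_add_div hd, norm_div, norm_div]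
  refine div_lt_div_of_pos_right ?_ (norm_pos_iff.2 hd)
  rw [add_sub_sub_cancel, add_add_sub_cancel, ← two_mul, ← two_mul, norm_mul, norm_mul, norm_inv]
  exact mul_lt_mul_of_pos_left ((inv_lt_one_of_one_lt₀ hz).trans hz) (by simp)

theorem sqrt_one_sub_eq {z : ℂ} (hz : 1 < ‖z‖) :
    (1 - 4 / (z + z⁻¹) ^ 2) ^ (1 / 2 : ℂ) = (z - z⁻¹) / (z + z⁻¹) := by
  have hsq : 1 - 4 / (z + z⁻¹) ^ 2 = ((z - z⁻¹) / (z + z⁻¹)) ^ 2 := by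
    rw [div_pow, one_sub_div (pow_ne_zero 2 (add_inv_ne_zero hz))]
    congr 1
    linear_combination 4 * mul_inv_cancel₀ (ne_zero_of_one_lt_norm hz)
  rw [hsq, one_div, Complex.sq_cpow_two_inv (re_sub_inv_div_add_inv_pos hz)]

/-- Half the summand of the identity for `q = 0`: `η(a) = (1 - √(1 - 4 / a²)) / 2`. -/
def eta (a : ℂ) : ℂ := (1 - (1 - 4 / a ^ 2) ^ (1 / 2 : ℂ)) / 2

theorem eta_mul_one_sub (a : ℂ) : eta a * (1 - eta a) = 1 / a ^ 2 := by
  have hsq : ((1 - 4 / a ^ 2) ^ (1 / 2 : ℂ)) ^ 2 = 1 - 4 / a ^ 2 := by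
    rw [one_div, Complex.cpow_ofNat_inv_pow]
  unfold eta
  linear_combination (-1 / 4) * hsq

theorem re_eta_lt {a : ℂ} (ha : IsLoxodromic a) : (eta a).re < 1 / 2 := by
  obtain ⟨z, hz, rfl⟩ := ha.exists_one_lt_norm_add_inv_eq
  have hre := re_sub_inv_div_add_inv_pos hz
  rw [eta, sqrt_one_sub_eq hz, Complex.div_ofNat_re, Complex.sub_re, Complex.one_re]
  linarith

/-- Since `Re η < 1/2`, the factor `1 - η` in `η (1 - η) = 1 / a²` has norm at least `1/2`. -/
theorem norm_eta_le {a : ℂ} (ha : IsLoxodromic a) : ‖eta a‖ ≤ 4 / ‖a‖ ^ 2 / 2 := by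
  have hprod := congrArg norm (eta_mul_one_sub a)
  rw [norm_mul, norm_div, norm_one, norm_pow] at hprod
  have hre := (Complex.re_le_norm (1 - eta a)).trans' (sub_lt_sub_left (re_eta_lt ha) 1).le
  rw [show 4 / ‖a‖ ^ 2 / 2 = 2 * (1 / ‖a‖ ^ 2) by ring, ← hprod]
  nlinarith [norm_nonneg (eta a)]

end Eta

/-! ### Decay of the weights of geodesics -/

section Weights

variable {ι : Type*} [Fintype ι] [DecidableEq ι]

theorem sum_compl_singleton_le {f : ι → ℝ} {i g : ι} (hgi : g ≠ i) {a δ : ℝ} (hδ : 0 ≤ δ)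
    (hg : f g ≤ a) (hf : ∀ j, j ≠ i → j ≠ g → f j ≤ δ) :
    ∑ j ∈ ({i} : Finset ι)ᶜ, f j ≤ a + Fintype.card ι * δ := by
  have hmem : g ∈ ({i} : Finset ι)ᶜ := by simpa using hgi
  rw [← Finset.add_sum_erase _ _ hmem]
  refine add_le_add hg ((Finset.sum_le_card_nsmul _ _ δ fun j hj => ?_).trans ?_)
  · rw [Finset.mem_erase, Finset.mem_compl, Finset.mem_singleton] at hj
    exact hf j hj.2 hj.1
  · rw [nsmul_eq_mul]
    exact mul_le_mul_of_nonneg_right (Nat.cast_le.2 (Finset.card_le_univ _)) hδ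

/-- The weight `4 / |φ(γ)|²` of the geodesic with colours `i`, `j` through a vertex with
coordinates `x`; it bounds the size of the summand of `γ`. -/
def geoWeight (x : ι → ℂ) (i j : ι) : ℝ := 4 / ‖pairProd x i j‖ ^ 2

theorem geoWeight_nonneg (x : ι → ℂ) (i j : ι) : 0 ≤ geoWeight x i j := by
  unfold geoWeight
  positivity

theorem geoWeight_comm (x : ι → ℂ) (i j : ι) : geoWeight x i j = geoWeight x j i := by
  rw [geoWeight, pairProd_comm, geoWeight]

theorem geoWeight_le {x : ι → ℂ} {i j : ι} {K : ℝ} (hK : 0 < K) (h : K ≤ ‖pairProd x i j‖) :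
    geoWeight x i j ≤ 4 / K ^ 2 := by
  unfold geoWeight
  gcongr

namespace BowditchSystem

variable {μ : ℂ} {X : List ι → ι → ℂ} (S : BowditchSystem μ X)

include S

theorem geoWeight_cons_left (l : List ι) (i j : ι) :
    geoWeight (X (i :: l)) j i = geoWeight (X l) i j := by
  rw [geoWeight_comm, geoWeight, S.pairProd_cons, geoWeight]

theorem mul_coProd_cons (l : List ι) {i j : ι} (hj : j ≠ i) :
    X l j * coProd (X (i :: l)) j = X (i :: l) i * coProd (X l) i := by
  rw [← S.coProd_cons i l, ← prod_eq_mul_coProd, prod_eq_mul_coProd _ j, S.of_ne _ _ _ hj]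

theorem mul_pairProd_cons (l : List ι) {i j k : ι} (hj : j ≠ i) (hk : k ≠ i) (hjk : j ≠ k) :
    X l j * pairProd (X (i :: l)) j k = X (i :: l) i * pairProd (X l) i k := by
  have h := S.mul_coProd_cons l hj
  rw [coProd_eq_mul_pairProd _ hjk, coProd_eq_mul_pairProd _ hk.symm, S.of_ne _ _ _ hk] at h
  exact mul_left_cancel₀ (S.ne_zero l k) (by linear_combination h)

theorem geoWeight_cons (l : List ι) {i j k : ι} (hj : j ≠ i) (hk : k ≠ i) (hjk : j ≠ k) :
    geoWeight (X (i :: l)) j k = turnRatio X l i j * geoWeight (X l) i k := by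
  have h := congrArg norm (S.mul_pairProd_cons l hj hk hjk)
  rw [norm_mul, norm_mul] at h
  have hXi := norm_ne_zero_iff.2 (S.ne_zero (i :: l) i)
  have hPjk := norm_ne_zero_iff.2 (S.pairProd_ne_zero hjk (i :: l))
  have hPik := norm_ne_zero_iff.2 (S.pairProd_ne_zero hk.symm l)
  rw [geoWeight, geoWeight, turnRatio, div_mul_div_comm,
    div_eq_div_iff (by positivity) (by positivity), ← mul_pow, ← h]
  ring

theorem turnRatio_le_geoWeight {l : List ι} {i j : ι} (hij : i ≠ j) (h : ¬ IsOutward X l i) :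
    turnRatio X l i j ≤ geoWeight (X l) i j := by
  have hle : ‖X l i‖ ≤ ‖X (i :: l) i‖ := not_lt.1 h
  have hmul : ‖pairProd (X l) i j‖ * ‖X l j‖ ≤ 2 * ‖X (i :: l) i‖ := by
    linarith [S.norm_pairProd_mul_le hij l]
  have hX := norm_pos_iff.2 (S.ne_zero (i :: l) i)
  have hP := norm_pos_iff.2 (S.pairProd_ne_zero hij l)
  rw [turnRatio, geoWeight, div_le_div_iff₀ (by positivity) (by positivity)]
  calc ‖X l j‖ ^ 2 * ‖pairProd (X l) i j‖ ^ 2 = (‖pairProd (X l) i j‖ * ‖X l j‖) ^ 2 := by ring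
    _ ≤ (2 * ‖X (i :: l) i‖) ^ 2 := by gcongr
    _ = 4 * ‖X (i :: l) i‖ ^ 2 := by ring

theorem exists_geoWeight_le_and_turnRatio_le :
    ∃ ρ ∈ Set.Ioo (0 : ℝ) 1,
      (∀ᶠ l in cofinite, ∀ i j, i ≠ j → IsBase {i, j} l → geoWeight (X l) i j ≤ ρ) ∧
      ∀ᶠ l in cofinite, ∀ i j, i ≠ j → IsReducedWord (i :: l) → turnRatio X l i j ≤ ρ := by
  obtain ⟨K, hK, hbound⟩ := S.exists_bound
  obtain ⟨s, hs1, hgrowth⟩ := S.exists_geodesicGrowth_of_norm_le hbound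
  have hK0 : 0 < K := by linarith
  have hK1 : 4 / K ^ 2 < 1 := by
    rw [div_lt_one (by positivity)]
    nlinarith
  refine ⟨max s (4 / K ^ 2), ⟨lt_max_of_lt_right (by positivity), max_lt hs1 hK1⟩, ?_, ?_⟩
  · filter_upwards [hbound] with l hl i j hij hb
    exact (geoWeight_le hK0 (hl i j hij hb).le).trans (le_max_right _ _)
  · filter_upwards [hgrowth, S.eventually_not_isOutward] with l hl hin i j hij hred
    rcases le_or_gt ‖pairProd (X l) i j‖ K with hp | hp
    · exact (hl i j hij hred hp).turnRatio_le.trans (le_max_left _ _)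
    · exact ((S.turnRatio_le_geoWeight hij (hin i hred)).trans (geoWeight_le hK0 hp.le)).trans
        (le_max_right _ _)

theorem geoWeight_cons_le {ρ δ : ℝ} {l : List ι}
    (hturn : ∀ i j, i ≠ j → IsReducedWord (i :: l) → turnRatio X l i j ≤ ρ)
    (hweight : ∀ i j, i ≠ j → IsBase {i, j} l → geoWeight (X l) i j ≤ δ) {i j k : ι} (hjk : j ≠ k)
    (hb : IsBase {j, k} (i :: l)) :
    geoWeight (X (i :: l)) j k ≤ ρ * δ := by
  obtain ⟨hj, hil⟩ := isReducedWord_cons_cons.1 hb.left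
  obtain ⟨hk, -⟩ := isReducedWord_cons_cons.1 hb.right
  wlog hkl : IsReducedWord (k :: l) generalizing j k
  · rw [geoWeight_comm]
    exact this hjk.symm hb.symm hk hj ((isReducedWord_cons_or_cons hjk hil.tail).resolve_right hkl)
  have hik : IsBase {i, k} l := isBase_pair.2 ⟨hil, hkl⟩
  rw [S.geoWeight_cons l hj hk hjk]
  have hρ := (turnRatio_nonneg X l i j).trans (hturn i j hj.symm hil)
  exact mul_le_mul (hturn i j hj.symm hil) (hweight i k hk.symm hik) (geoWeight_nonneg _ _ _) hρ

theorem eventually_geoWeight_le {δ : ℝ} (hδ : 0 < δ) :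
    ∀ᶠ l in cofinite, ∀ i j, i ≠ j → IsBase {i, j} l → geoWeight (X l) i j ≤ δ := by
  obtain ⟨ρ, ⟨hρ0, hρ1⟩, hweight, hturn⟩ := S.exists_geoWeight_le_and_turnRatio_le
  have hpow : ∀ a : ℕ, ∀ᶠ l in cofinite, ∀ i j, i ≠ j → IsBase {i, j} l →
      geoWeight (X l) i j ≤ ρ ^ (a + 1) := by
    intro a
    induction a with
    | zero => simpa only [zero_add, pow_one] using hweight
    | succ a ih =>
      apply eventually_cofinite_of_forall_cons
      filter_upwards [ih, hturn] with l hl ht i j k hjk hb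
      rw [pow_succ']
      exact S.geoWeight_cons_le ht hl hjk hb
  obtain ⟨a, ha⟩ := exists_pow_lt_of_lt_one hδ hρ1
  filter_upwards [hpow a] with l hl i j hij hb
  exact (hl i j hij hb).trans ((pow_le_pow_of_le_one hρ0.le hρ1.le a.le_succ).trans ha.le)

theorem eventually_exists_geoWeight_le {δ : ℝ} (hδ : 0 < δ) :
    ∀ᶠ l in cofinite, ∀ i, IsReducedWord (i :: l) →
      ∃ g, g ≠ i ∧ ∀ j, j ≠ i → j ≠ g → geoWeight (X l) i j ≤ δ := by
  filter_upwards [S.eventually_geoWeight_le hδ, (Set.finite_singleton []).compl_mem_cofinite]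
    with l hl hne i hi
  obtain ⟨g, l, rfl⟩ := List.exists_cons_of_ne_nil hne
  refine ⟨g, (isReducedWord_cons_cons.1 hi).1.symm, fun j hji hjg => hl i j hji.symm ?_⟩
  exact isBase_pair.2 ⟨hi, isReducedWord_cons_cons.2 ⟨hjg, hi.tail⟩⟩

theorem exists_sum_turnRatio_le :
    ∃ s < (1 : ℝ), ∀ᶠ l in cofinite, ∀ i, IsReducedWord (i :: l) →
      ∑ j ∈ ({i} : Finset ι)ᶜ, turnRatio X l i j ≤ s := by
  obtain ⟨ρ, ⟨-, hρ1⟩, -, hturn⟩ := S.exists_geoWeight_le_and_turnRatio_le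
  have hcard : (0 : ℝ) < Fintype.card ι :=
    Nat.cast_pos.2 ((Nat.succ_pos 2).trans_le S.three_le)
  set δ := (1 - ρ) / (2 * Fintype.card ι) with hδ
  have hδ0 : 0 < δ := div_pos (sub_pos.2 hρ1) (by positivity)
  have hsum : Fintype.card ι * δ = (1 - ρ) / 2 := by
    rw [hδ]
    field_simp
  refine ⟨ρ + Fintype.card ι * δ, by linarith, ?_⟩
  filter_upwards [S.eventually_exists_geoWeight_le hδ0, S.eventually_not_isOutward, hturn]
    with l hl hin ht i hi
  obtain ⟨g, hgi, hg⟩ := hl i hi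
  exact sum_compl_singleton_le hgi hδ0.le (ht i g hgi.symm hi) fun j hji hjg =>
    (S.turnRatio_le_geoWeight hji.symm (hin i hi)).trans (hg j hji hjg)

theorem norm_eta_pairProd_le (l : List ι) {i j : ι} (hij : i ≠ j) :
    ‖eta (pairProd (X l) i j)‖ ≤ geoWeight (X l) i j / 2 :=
  norm_eta_le (S.isLoxodromic_pairProd l i j hij)

theorem exists_re_eta_le :
    ∃ c > 0, ∀ l i j, i ≠ j → IsReducedWord l → (eta (pairProd (X l) i j)).re ≤ 1 / 2 - c := by
  obtain ⟨ρ, ⟨-, hρ1⟩, hweight, -⟩ := S.exists_geoWeight_le_and_turnRatio_le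
  obtain ⟨R, hR⟩ := eventually_cofinite_iff_length.1 hweight
  have hshort : ∀ᶠ c in 𝓝[>] (0 : ℝ), ∀ l i j, i ≠ j → IsReducedWord l → l.length < R →
      (eta (pairProd (X l) i j)).re ≤ 1 / 2 - c := by
    refine eventually_forall_length_lt fun l i j hij _ _ => ?_
    have hlt := sub_pos.2 (re_eta_lt (S.isLoxodromic_pairProd l i j hij))
    filter_upwards [Ioo_mem_nhdsGT hlt] with c hc
    linarith [hc.2]
  have hlong : ∀ᶠ c in 𝓝[>] (0 : ℝ), c ∈ Set.Ioo (0 : ℝ) ((1 - ρ) / 2) :=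
    Ioo_mem_nhdsGT (by linarith)
  obtain ⟨c, hc, hc0, hcρ⟩ := (hshort.and hlong).exists
  refine ⟨c, hc0, fun l i j hij hl => ?_⟩
  rw [← S.pairProd_strip]
  rcases lt_or_ge (strip {i, j} l).length R with hlen | hlen
  · exact hc _ i j hij (isReducedWord_strip hl) hlen
  · have hnorm := S.norm_eta_pairProd_le (strip {i, j} l) hij
    linarith [(Complex.re_le_norm _).trans hnorm, hR _ hlen i j hij (isBase_strip hl)]

end BowditchSystem

end Weights

/-! ### Spheres in the tree -/

section Spheres

variable {ι : Type*} [Fintype ι] [DecidableEq ι]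

/-- The colours of the edges that lead from `l` away from the root. -/
def childColours (l : List ι) : Finset ι := {i | IsReducedWord (i :: l)}

theorem mem_childColours {l : List ι} {i : ι} : i ∈ childColours l ↔ IsReducedWord (i :: l) := by
  simp [childColours]

theorem childColours_nil : childColours ([] : List ι) = Finset.univ := by
  ext i
  simp [mem_childColours]

theorem childColours_cons {i : ι} {l : List ι} (h : IsReducedWord (i :: l)) :
    childColours (i :: l) = {i}ᶜ := by
  ext j
  simp [mem_childColours, h]

variable (ι) in
/-- The vertices at distance `d` from the root. -/
def sphere : ℕ → Finset (List ι)
  | 0 => {[]}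
  | d + 1 => (sphere d).biUnion fun l => (childColours l).image (· :: l)

theorem mem_sphere {d : ℕ} {l : List ι} : l ∈ sphere ι d ↔ IsReducedWord l ∧ l.length = d := by
  induction d generalizing l with
  | zero =>
    rw [sphere, Finset.mem_singleton, List.length_eq_zero_iff]
    exact ⟨fun h => ⟨h ▸ List.IsChain.nil, h⟩, And.right⟩
  | succ d ih =>
    simp only [sphere, Finset.mem_biUnion, Finset.mem_image, ih, mem_childColours]
    constructor
    · rintro ⟨l, ⟨-, hlen⟩, i, hi, rfl⟩
      exact ⟨hi, by rw [List.length_cons, hlen]⟩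
    · rintro ⟨hl, hlen⟩
      obtain ⟨i, l, rfl⟩ := List.exists_cons_of_length_eq_add_one hlen
      exact ⟨l, ⟨hl.tail, Nat.succ.inj hlen⟩, i, hl, rfl⟩

/-- The sum over the edges `{l, i :: l}` from the sphere of radius `d` to the next one. -/
def edgeSum {M : Type*} [AddCommMonoid M] (d : ℕ) (F : List ι → ι → M) : M :=
  ∑ l ∈ sphere ι d, ∑ i ∈ childColours l, F l i

theorem edgeSum_zero {M : Type*} [AddCommMonoid M] (F : List ι → ι → M) :
    edgeSum 0 F = ∑ i, F [] i := by
  rw [edgeSum, sphere, Finset.sum_singleton, childColours_nil]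

theorem sum_sphere_succ {M : Type*} [AddCommMonoid M] (d : ℕ) (F : List ι → M) :
    ∑ l ∈ sphere ι (d + 1), F l = edgeSum d fun l i => F (i :: l) := by
  rw [edgeSum, sphere, Finset.sum_biUnion]
  · exact Finset.sum_congr rfl fun l _ =>
      Finset.sum_image fun i _ j _ h => List.head_eq_of_cons_eq h
  · intro l _ l' _ hne
    rw [Function.onFun, Finset.disjoint_left]
    intro w hw hw'
    obtain ⟨i, -, rfl⟩ := Finset.mem_image.1 hw
    obtain ⟨j, -, h⟩ := Finset.mem_image.1 hw'
    exact hne (List.tail_eq_of_cons_eq h).symm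

theorem edgeSum_congr {M : Type*} [AddCommMonoid M] {d : ℕ} {F G : List ι → ι → M}
    (h : ∀ l i, IsReducedWord (i :: l) → F l i = G l i) : edgeSum d F = edgeSum d G :=
  Finset.sum_congr rfl fun l _ => Finset.sum_congr rfl fun i hi => h l i (mem_childColours.1 hi)

theorem edgeSum_succ {M : Type*} [AddCommMonoid M] (d : ℕ) (F : List ι → ι → M) :
    edgeSum (d + 1) F = edgeSum d fun l i => ∑ j ∈ ({i} : Finset ι)ᶜ, F (i :: l) j :=
  (sum_sphere_succ d fun l => ∑ i ∈ childColours l, F l i).trans <| edgeSum_congr fun l i hi => by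
    rw [childColours_cons hi]

theorem edgeSum_le {d : ℕ} {F G : List ι → ι → ℝ}
    (h : ∀ l i, l.length = d → IsReducedWord (i :: l) → F l i ≤ G l i) :
    edgeSum d F ≤ edgeSum d G :=
  Finset.sum_le_sum fun l hl => Finset.sum_le_sum fun i hi =>
    h l i (mem_sphere.1 hl).2 (mem_childColours.1 hi)

theorem edgeSum_nonneg {d : ℕ} {F : List ι → ι → ℝ} (h : ∀ l i, 0 ≤ F l i) : 0 ≤ edgeSum d F :=
  Finset.sum_nonneg fun l _ => Finset.sum_nonneg fun i _ => h l i

theorem edgeSum_mul_left (d : ℕ) (c : ℝ) (F : List ι → ι → ℝ) :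
    edgeSum d (fun l i => c * F l i) = c * edgeSum d F := by
  simp only [edgeSum, Finset.mul_sum]

theorem edgeSum_add {M : Type*} [AddCommMonoid M] (d : ℕ) (F G : List ι → ι → M) :
    edgeSum d (fun l i => F l i + G l i) = edgeSum d F + edgeSum d G := by
  simp only [edgeSum, Finset.sum_add_distrib]

theorem edgeSum_sub {M : Type*} [AddCommGroup M] (d : ℕ) (F G : List ι → ι → M) :
    edgeSum d (fun l i => F l i - G l i) = edgeSum d F - edgeSum d G := by
  simp only [edgeSum, Finset.sum_sub_distrib]

theorem norm_edgeSum_le {M : Type*} [SeminormedAddCommGroup M] (d : ℕ) (F : List ι → ι → M) :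
    ‖edgeSum d F‖ ≤ edgeSum d fun l i => ‖F l i‖ :=
  norm_sum_le_of_le _ fun _ _ => norm_sum_le _ _

variable (ι) in
/-- The vertices of the Cayley tree, as reduced words. -/
abbrev ReducedWord : Type _ := {l : List ι // IsReducedWord l}

variable (ι) in
/-- The vertices of the tree, sorted by their distance from the root. -/
def sigmaSphereEquiv : (Σ d, {l // l ∈ sphere ι d}) ≃ ReducedWord ι where
  toFun x := ⟨x.2.1, (mem_sphere.1 x.2.2).1⟩
  invFun v := ⟨v.1.length, v.1, mem_sphere.2 ⟨v.2, rfl⟩⟩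
  left_inv := by
    rintro ⟨d, l, hl⟩
    obtain rfl := (mem_sphere.1 hl).2
    rfl
  right_inv _ := rfl

theorem summable_of_summable_sum_sphere {f : List ι → ℝ} (hf : ∀ l, 0 ≤ f l)
    (h : Summable fun d => ∑ l ∈ sphere ι d, f l) : Summable fun v : ReducedWord ι => f v.1 := by
  rw [← (sigmaSphereEquiv ι).summable_iff]
  refine (summable_sigma_of_nonneg fun _ => hf _).2 ⟨fun d => Summable.of_finite, ?_⟩
  refine h.congr fun d => ?_
  rw [← Finset.tsum_subtype]
  rfl

theorem tendsto_sum_sphere {M : Type*} [AddCommMonoid M] [TopologicalSpace M] [ContinuousAdd M]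
    [RegularSpace M] {f : List ι → M} {a : M} (h : HasSum (fun v : ReducedWord ι => f v.1) a) :
    Tendsto (fun D => ∑ d ∈ Finset.range D, ∑ l ∈ sphere ι d, f l) atTop (𝓝 a) := by
  refine (((sigmaSphereEquiv ι).hasSum_iff.2 h).sigma fun d => ?_).tendsto_sum_nat
  rw [← Finset.sum_coe_sort (sphere ι d) f]
  exact hasSum_fintype fun l : {l // l ∈ sphere ι d} => f l.1

end Spheres

theorem sum_offDiag {ι M : Type*} [DecidableEq ι] [AddCommMonoid M] (s : Finset ι)
    (f : ι → ι → M) : ∑ p ∈ s.offDiag, f p.1 p.2 = ∑ j ∈ s, ∑ k ∈ s.erase j, f j k :=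
  Finset.sum_finset_product' _ _ _ fun p => by
    rw [Finset.mem_offDiag, Finset.mem_erase]
    tauto

theorem sum_offDiag_mul {ι R : Type*} [CommRing R] (s : Finset ι) (f : ι → R) :
    ∑ p ∈ s.offDiag, f p.1 * f p.2 = (∑ j ∈ s, f j) ^ 2 - ∑ j ∈ s, f j ^ 2 := by
  classical
  rw [sq, Finset.sum_mul_sum, ← Finset.sum_product', ← Finset.diag_union_offDiag,
    Finset.sum_union (Finset.disjoint_diag_offDiag s), Finset.sum_diag]
  simp only [sq, add_sub_cancel_left]

/-! ### Summability over the tree -/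

section Summability

variable {ι : Type*} [Fintype ι] [DecidableEq ι]

/-- The total product of the weights of two distinct geodesics through the edge of colour `i` at a
vertex with coordinates `x`, over ordered pairs. -/
def crossWeight (x : ι → ℂ) (i : ι) : ℝ :=
  ∑ p ∈ (({i} : Finset ι)ᶜ).offDiag, geoWeight x i p.1 * geoWeight x i p.2

/-- The weight of the edge of colour `i` at a vertex with coordinates `x`. It bounds the defect of
the edge identity and the contributions of the endpoint further from the root. -/
def edgeWeight (x : ι → ℂ) (i : ι) : ℝ := 1 / ‖coProd x i‖ ^ 2 + crossWeight x i

theorem crossWeight_nonneg (x : ι → ℂ) (i : ι) : 0 ≤ crossWeight x i :=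
  Finset.sum_nonneg fun _ _ => mul_nonneg (geoWeight_nonneg _ _ _) (geoWeight_nonneg _ _ _)

theorem crossWeight_le_edgeWeight (x : ι → ℂ) (i : ι) : crossWeight x i ≤ edgeWeight x i :=
  le_add_of_nonneg_left (by positivity)

theorem one_div_le_edgeWeight (x : ι → ℂ) (i : ι) : 1 / ‖coProd x i‖ ^ 2 ≤ edgeWeight x i :=
  le_add_of_nonneg_right (crossWeight_nonneg x i)

theorem edgeWeight_nonneg (x : ι → ℂ) (i : ι) : 0 ≤ edgeWeight x i :=
  (crossWeight_nonneg x i).trans (crossWeight_le_edgeWeight x i)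

theorem mem_offDiag_compl_singleton {i : ι} {p : ι × ι} :
    p ∈ (({i} : Finset ι)ᶜ).offDiag ↔ p.1 ≠ i ∧ p.2 ≠ i ∧ p.1 ≠ p.2 := by
  simp only [Finset.mem_offDiag, Finset.mem_compl, Finset.mem_singleton]

/-- The sum of `eta` over the geodesics whose vertex closest to the root is `l`; each geodesic
occurs twice, as the sum is over ordered pairs of colours. -/
def baseSum (X : List ι → ι → ℂ) (l : List ι) : ℂ :=
  ∑ p ∈ (childColours l).offDiag, eta (pairProd (X l) p.1 p.2)

namespace BowditchSystem

variable {μ : ℂ} {X : List ι → ι → ℂ} (S : BowditchSystem μ X)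

include S

theorem crossWeight_cons_le (l : List ι) {i j : ι} (hj : j ≠ i) (ht : turnRatio X l i j ≤ 1) :
    crossWeight (X (i :: l)) j ≤ turnRatio X l i j * crossWeight (X l) i := by
  rw [crossWeight, crossWeight, Finset.mul_sum]
  have ht0 := turnRatio_nonneg X l i j
  have hw := geoWeight_nonneg (X l) i
  have hswap : ∀ k, k ≠ i → k ≠ j → geoWeight (X (i :: l)) j (Equiv.swap i j k) =
      turnRatio X l i j * geoWeight (X l) i k := fun k hki hkj => by
    rw [Equiv.swap_apply_of_ne_of_ne hki hkj, S.geoWeight_cons l hj hki hkj.symm]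
  have hswap' : geoWeight (X (i :: l)) j (Equiv.swap i j j) = geoWeight (X l) i j := by
    rw [Equiv.swap_apply_right, S.geoWeight_cons_left]
  calc ∑ p ∈ (({j} : Finset ι)ᶜ).offDiag,
        geoWeight (X (i :: l)) j p.1 * geoWeight (X (i :: l)) j p.2
      = ∑ p ∈ (({i} : Finset ι)ᶜ).offDiag, geoWeight (X (i :: l)) j (Equiv.swap i j p.1) *
          geoWeight (X (i :: l)) j (Equiv.swap i j p.2) := by
        refine (Finset.sum_equiv ((Equiv.swap i j).prodCongr (Equiv.swap i j)) (fun p => ?_)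
          fun _ _ => rfl).symm
        simp [Equiv.swap_apply_eq_iff]
    _ ≤ ∑ p ∈ (({i} : Finset ι)ᶜ).offDiag,
          turnRatio X l i j * (geoWeight (X l) i p.1 * geoWeight (X l) i p.2) := by
        refine Finset.sum_le_sum fun ⟨k, m⟩ hp => ?_
        obtain ⟨hki, hmi, hkm⟩ := mem_offDiag_compl_singleton.1 hp
        dsimp only at hki hmi hkm ⊢
        rcases eq_or_ne k j with rfl | hkj
        · rw [hswap', hswap m hmi hkm.symm, mul_left_comm]
        · rw [hswap k hki hkj, mul_assoc]
          refine mul_le_mul_of_nonneg_left (mul_le_mul_of_nonneg_left ?_ (hw k)) ht0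
          rcases eq_or_ne m j with rfl | hmj
          · rw [hswap']
          · rw [hswap m hmi hmj]
            exact mul_le_of_le_one_left (hw m) ht

theorem edgeWeight_cons_le (l : List ι) {i j : ι} (hj : j ≠ i) (ht : turnRatio X l i j ≤ 1) :
    edgeWeight (X (i :: l)) j ≤ turnRatio X l i j * edgeWeight (X l) i := by
  rw [edgeWeight, edgeWeight, mul_add]
  refine add_le_add (le_of_eq ?_) (S.crossWeight_cons_le l hj ht)
  have h := congrArg norm (S.mul_coProd_cons l hj)
  rw [norm_mul, norm_mul] at h
  have hXi := norm_ne_zero_iff.2 (S.ne_zero (i :: l) i)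
  have hPj := norm_ne_zero_iff.2 (S.coProd_ne_zero (i :: l) j)
  have hPi := norm_ne_zero_iff.2 (S.coProd_ne_zero l i)
  rw [turnRatio, div_mul_div_comm, div_eq_div_iff (by positivity) (by positivity), ← mul_pow, ← h]
  ring

theorem summable_edgeSum_edgeWeight :
    Summable fun d => edgeSum d fun l i => edgeWeight (X l) i := by
  have hnonneg : ∀ l i, 0 ≤ edgeWeight (X l) i := fun l => edgeWeight_nonneg (X l)
  obtain ⟨s, hs1, hs⟩ := S.exists_sum_turnRatio_le
  obtain ⟨R, hR⟩ := eventually_cofinite_iff_length.1 hs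
  refine summable_of_ratio_norm_eventually_le hs1 (eventually_atTop.2 ⟨R, fun d hd => ?_⟩)
  rw [Real.norm_of_nonneg (edgeSum_nonneg hnonneg), Real.norm_of_nonneg (edgeSum_nonneg hnonneg),
    edgeSum_succ, ← edgeSum_mul_left]
  refine edgeSum_le fun l i hl hi => ?_
  have hsum := hR l (hl ▸ hd) i hi
  refine le_trans ?_ (mul_le_mul_of_nonneg_right hsum (hnonneg l i))
  rw [Finset.sum_mul]
  refine Finset.sum_le_sum fun j hj => S.edgeWeight_cons_le l (by simpa using hj) ?_
  exact (Finset.single_le_sum (fun k _ => turnRatio_nonneg X l i k) hj).trans (hsum.trans hs1.le)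

theorem summable_of_eventually_le_edgeWeight {f : List ι → ℝ} (hf : ∀ l, 0 ≤ f l) {C : ℝ}
    (h : ∀ᶠ l in cofinite, ∀ i, IsReducedWord (i :: l) → f (i :: l) ≤ C * edgeWeight (X l) i) :
    Summable fun v : ReducedWord ι => f v.1 := by
  apply summable_of_summable_sum_sphere hf
  obtain ⟨R, hR⟩ := eventually_cofinite_iff_length.1 h
  rw [← summable_nat_add_iff (R + 1)]
  refine Summable.of_nonneg_of_le (fun d => Finset.sum_nonneg fun l _ => hf l) (fun d => ?_)
    (((summable_nat_add_iff R).2 S.summable_edgeSum_edgeWeight).mul_left C)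
  rw [← add_assoc, sum_sphere_succ, ← edgeSum_mul_left]
  exact edgeSum_le fun l i hl hi => hR l (by omega) i hi

theorem norm_coProd_le_of_not_isOutward {l : List ι} {i : ι} (h : ¬ IsOutward X l i) :
    ‖coProd (X l) i‖ ≤ 2 * ‖X (i :: l) i‖ := by
  rw [← S.edge l i]
  linarith [norm_add_le (X l i) (X (i :: l) i), not_lt.1 h]

theorem summable_norm_inv_prod : Summable fun v : ReducedWord ι => ‖(∏ k, X v.1 k)⁻¹‖ := by
  refine S.summable_of_eventually_le_edgeWeight (f := fun l => ‖(∏ k, X l k)⁻¹‖) (C := 2)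
    (fun _ => norm_nonneg _) ?_
  filter_upwards [S.eventually_not_isOutward] with l hl i hi
  refine le_trans ?_ (mul_le_mul_of_nonneg_left (one_div_le_edgeWeight (X l) i) zero_le_two)
  have hle := S.norm_coProd_le_of_not_isOutward (hl i hi)
  have hP := norm_pos_iff.2 (S.coProd_ne_zero l i)
  have hX := norm_pos_iff.2 (S.ne_zero (i :: l) i)
  rw [prod_eq_mul_coProd _ i, S.coProd_cons, norm_inv, norm_mul, inv_eq_one_div, mul_one_div,
    div_le_div_iff₀ (by positivity) (by positivity)]
  nlinarith

theorem summable_inv_prod : Summable fun v : ReducedWord ι => (∏ k, X v.1 k)⁻¹ :=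
  S.summable_norm_inv_prod.of_norm

theorem sum_norm_eta_cons_le {l : List ι} {i : ι} (hi : IsReducedWord (i :: l))
    (h : ¬ IsOutward X l i) :
    ∑ p ∈ (childColours (i :: l)).offDiag, ‖eta (pairProd (X (i :: l)) p.1 p.2)‖ ≤
      crossWeight (X l) i := by
  rw [childColours_cons hi]
  refine Finset.sum_le_sum fun p hp => ?_
  obtain ⟨h1, h2, h12⟩ := mem_offDiag_compl_singleton.1 hp
  calc ‖eta (pairProd (X (i :: l)) p.1 p.2)‖ ≤ geoWeight (X (i :: l)) p.1 p.2 :=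
        (S.norm_eta_pairProd_le _ h12).trans (half_le_self (geoWeight_nonneg _ _ _))
    _ = turnRatio X l i p.1 * geoWeight (X l) i p.2 := S.geoWeight_cons l h1 h2 h12
    _ ≤ geoWeight (X l) i p.1 * geoWeight (X l) i p.2 :=
        mul_le_mul_of_nonneg_right (S.turnRatio_le_geoWeight h1.symm h) (geoWeight_nonneg _ _ _)

theorem summable_sum_norm_eta : Summable fun v : ReducedWord ι =>
    ∑ p ∈ (childColours v.1).offDiag, ‖eta (pairProd (X v.1) p.1 p.2)‖ := by
  refine S.summable_of_eventually_le_edgeWeight (C := 1)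
    (f := fun l => ∑ p ∈ (childColours l).offDiag, ‖eta (pairProd (X l) p.1 p.2)‖)
    (fun _ => Finset.sum_nonneg fun _ _ => norm_nonneg _) ?_
  filter_upwards [S.eventually_not_isOutward] with l hl i hi
  rw [one_mul]
  exact (S.sum_norm_eta_cons_le hi (hl i hi)).trans (crossWeight_le_edgeWeight _ _)

theorem summable_baseSum : Summable fun v : ReducedWord ι => baseSum X v.1 :=
  S.summable_sum_norm_eta.of_norm_bounded fun _ => norm_sum_le _ _

end BowditchSystem

end Summability

/-! ### The edge identity -/

section EdgeIdentity

variable {ι : Type*} [Fintype ι] [DecidableEq ι]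

/-- The ratio `x_i / ∏_{k ≠ i} x_k` attached to the edge of colour `i` at a vertex with coordinates
`x`, oriented away from this vertex. The ratios of the two orientations of an edge add up to `1`. -/
def flow (x : ι → ℂ) (i : ι) : ℂ := x i / coProd x i

/-- The sum of `eta` over the geodesics through the edge of colour `i` at a vertex with
coordinates `x`. -/
def edgeEta (x : ι → ℂ) (i : ι) : ℂ := ∑ j ∈ ({i} : Finset ι)ᶜ, eta (pairProd x i j)

namespace BowditchSystem

variable {μ : ℂ} {X : List ι → ι → ℂ} (S : BowditchSystem μ X)

include S

theorem sum_flow (l : List ι) : ∑ i, flow (X l) i = 1 + μ * (∏ k, X l k)⁻¹ := by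
  have hprod : ∏ k, X l k ≠ 0 := Finset.prod_ne_zero_iff.2 fun k _ => S.ne_zero l k
  have hflow : ∀ i, flow (X l) i = X l i ^ 2 * (∏ k, X l k)⁻¹ := fun i => by
    have hX := S.ne_zero l i
    have hP := S.coProd_ne_zero l i
    rw [flow, prod_eq_mul_coProd _ i]
    field_simp
  simp_rw [hflow]
  rw [← Finset.sum_mul, sub_eq_iff_eq_add.1 (S.vertex l), add_mul, mul_inv_cancel₀ hprod, add_comm]

theorem flow_cons (l : List ι) (i : ι) : flow (X (i :: l)) i = 1 - flow (X l) i := by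
  rw [flow, flow, S.coProd_cons, eq_sub_iff_add_eq', ← add_div, S.edge,
    div_self (S.coProd_ne_zero l i)]

theorem edgeSum_flow (d : ℕ) :
    edgeSum d (fun l => flow (X l)) =
      1 + μ * ∑ e ∈ Finset.range (d + 1), ∑ l ∈ sphere ι e, (∏ k, X l k)⁻¹ := by
  induction d with
  | zero => simp [edgeSum_zero, sphere, S.sum_flow]
  | succ d ih =>
    rw [Finset.sum_range_succ, mul_add, ← add_assoc, ← ih, Finset.mul_sum, sum_sphere_succ,
      edgeSum_succ, ← edgeSum_add]
    refine edgeSum_congr fun l i _ => ?_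
    have hsum := S.sum_flow (i :: l)
    rw [Fintype.sum_eq_add_sum_compl i, S.flow_cons] at hsum
    linear_combination hsum

theorem edgeEta_cons (l : List ι) {i j : ι} (hji : j ≠ i) :
    edgeEta (X (i :: l)) j = eta (pairProd (X l) i j) +
      ∑ k ∈ (({i} : Finset ι)ᶜ).erase j, eta (pairProd (X (i :: l)) j k) := by
  have hcompl : ({j} : Finset ι)ᶜ = insert i ((({i} : Finset ι)ᶜ).erase j) := by
    ext k
    simp only [Finset.mem_compl, Finset.mem_insert, Finset.mem_singleton, Finset.mem_erase]
    grind
  rw [edgeEta, hcompl, Finset.sum_insert (by simp), pairProd_comm, S.pairProd_cons]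

theorem edgeSum_edgeEta (d : ℕ) :
    edgeSum d (fun l => edgeEta (X l)) =
      ∑ e ∈ Finset.range (d + 1), ∑ l ∈ sphere ι e, baseSum X l := by
  simp only [baseSum, fun l => sum_offDiag (childColours l) fun j k => eta (pairProd (X l) j k)]
  induction d with
  | zero =>
    simp only [edgeSum_zero, edgeEta, zero_add, Finset.range_one, Finset.sum_singleton, sphere,
      childColours_nil, Finset.compl_eq_univ_sdiff, Finset.sdiff_singleton_eq_erase]
  | succ d ih =>
    rw [Finset.sum_range_succ, ← ih, sum_sphere_succ, edgeSum_succ, ← edgeSum_add]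
    refine edgeSum_congr fun l i hi => ?_
    rw [childColours_cons hi, edgeEta, ← Finset.sum_add_distrib]
    exact Finset.sum_congr rfl fun j hj => S.edgeEta_cons l (by simpa using hj)

theorem eta_pairProd_sq (l : List ι) {i j : ι} (hij : i ≠ j) :
    eta (pairProd (X l) i j) ^ 2 =
      eta (pairProd (X l) i j) - X l j ^ 2 * (1 / coProd (X l) i ^ 2) := by
  have hX := S.ne_zero l j
  have hP := S.pairProd_ne_zero hij l
  have hcancel : X l j ^ 2 * (1 / coProd (X l) i ^ 2) = 1 / pairProd (X l) i j ^ 2 := by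
    rw [coProd_eq_mul_pairProd _ hij]
    field_simp
  rw [hcancel, ← eta_mul_one_sub]
  ring

theorem flow_sq (l : List ι) (i : ι) :
    flow (X l) i ^ 2 = flow (X l) i -
      (∑ k ∈ ({i} : Finset ι)ᶜ, X l k ^ 2 - μ) * (1 / coProd (X l) i ^ 2) := by
  have hP := S.coProd_ne_zero l i
  have hvertex := S.vertex l
  rw [Fintype.sum_eq_add_sum_compl i, prod_eq_mul_coProd _ i] at hvertex
  rw [← hvertex, flow]
  field_simp
  ring

/-- The linear terms cancel: the coefficients of the quadratic equations for the `eta`s and for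
`flow` are related by the vertex relation. -/
theorem defect_mul (l : List ι) (i : ι) :
    (flow (X l) i - edgeEta (X l) i) * (1 - flow (X l) i - edgeEta (X l) i) =
      ∑ p ∈ (({i} : Finset ι)ᶜ).offDiag,
        eta (pairProd (X l) i p.1) * eta (pairProd (X l) i p.2) - μ * (1 / coProd (X l) i ^ 2) := by
  have hsq : ∑ j ∈ ({i} : Finset ι)ᶜ, eta (pairProd (X l) i j) ^ 2 = edgeEta (X l) i -
      (∑ j ∈ ({i} : Finset ι)ᶜ, X l j ^ 2) * (1 / coProd (X l) i ^ 2) := by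
    rw [edgeEta, Finset.sum_mul, ← Finset.sum_sub_distrib]
    refine Finset.sum_congr rfl fun j hj => S.eta_pairProd_sq l ?_
    exact (by simpa using hj : j ≠ i).symm
  rw [sum_offDiag_mul _ fun j => eta (pairProd (X l) i j), hsq, ← edgeEta]
  linear_combination -S.flow_sq l i

theorem re_flow_le {l : List ι} {i : ι} (h : ¬ IsOutward X l i) : (flow (X l) i).re ≤ 1 / 2 := by
  have hle : ‖flow (X l) i‖ ≤ ‖1 - flow (X l) i‖ := by
    rw [← S.flow_cons, flow, flow, S.coProd_cons, norm_div, norm_div]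
    exact div_le_div_of_nonneg_right (not_lt.1 h) (norm_nonneg _)
  have hsq := pow_le_pow_left₀ (norm_nonneg _) hle 2
  rw [← Complex.normSq_eq_norm_sq, ← Complex.normSq_eq_norm_sq, Complex.normSq_apply,
    Complex.normSq_apply, Complex.sub_re, Complex.sub_im, Complex.one_re, Complex.one_im] at hsq
  nlinarith

theorem exists_re_edgeEta_le :
    ∃ c > 0, ∀ᶠ l in cofinite, ∀ i, IsReducedWord (i :: l) →
      (edgeEta (X l) i).re ≤ 1 / 2 - c := by
  obtain ⟨c, hc, hre⟩ := S.exists_re_eta_le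
  have hcard : (0 : ℝ) < Fintype.card ι := Nat.cast_pos.2 ((Nat.succ_pos 2).trans_le S.three_le)
  set δ := c / Fintype.card ι with hδ
  have hδ0 : 0 < δ := by positivity
  have hcδ : Fintype.card ι * (δ / 2) = c / 2 := by
    rw [hδ]
    field_simp
  refine ⟨c / 2, half_pos hc, ?_⟩
  filter_upwards [S.eventually_exists_geoWeight_le hδ0] with l hl i hi
  obtain ⟨g, hgi, hg⟩ := hl i hi
  have hsum := sum_compl_singleton_le hgi (half_pos hδ0).le (hre l i g hgi.symm hi.tail)
    fun j hji hjg => (Complex.re_le_norm _).trans <| (S.norm_eta_pairProd_le l hji.symm).trans <|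
      div_le_div_of_nonneg_right (hg j hji hjg) zero_le_two
  rw [edgeEta, Complex.re_sum]
  linarith

theorem norm_sum_eta_mul_eta_le (l : List ι) (i : ι) :
    ‖∑ p ∈ (({i} : Finset ι)ᶜ).offDiag,
      eta (pairProd (X l) i p.1) * eta (pairProd (X l) i p.2)‖ ≤ crossWeight (X l) i := by
  have hle : ∀ j, j ≠ i → ‖eta (pairProd (X l) i j)‖ ≤ geoWeight (X l) i j := fun j hj =>
    (S.norm_eta_pairProd_le l hj.symm).trans (half_le_self (geoWeight_nonneg _ _ _))
  refine norm_sum_le_of_le _ fun p hp => ?_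
  obtain ⟨h1, h2, -⟩ := mem_offDiag_compl_singleton.1 hp
  rw [norm_mul]
  exact mul_le_mul (hle _ h1) (hle _ h2) (norm_nonneg _) (geoWeight_nonneg _ _ _)

theorem norm_defect_mul_le (l : List ι) (i : ι) :
    ‖flow (X l) i - edgeEta (X l) i‖ * ‖1 - flow (X l) i - edgeEta (X l) i‖ ≤
      (1 + ‖μ‖) * edgeWeight (X l) i := by
  rw [← norm_mul, S.defect_mul]
  refine (norm_sub_le _ _).trans ?_
  rw [norm_mul, norm_div, norm_one, norm_pow, add_mul, one_mul]
  exact add_le_add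
    ((S.norm_sum_eta_mul_eta_le l i).trans (crossWeight_le_edgeWeight _ _))
    (mul_le_mul_of_nonneg_left (one_div_le_edgeWeight _ _) (norm_nonneg μ))

theorem exists_norm_defect_le : ∃ C, ∀ᶠ l in cofinite, ∀ i, IsReducedWord (i :: l) →
    ‖flow (X l) i - edgeEta (X l) i‖ ≤ C * edgeWeight (X l) i := by
  obtain ⟨c, hc, hre⟩ := S.exists_re_edgeEta_le
  refine ⟨(1 + ‖μ‖) / c, ?_⟩
  filter_upwards [hre, S.eventually_not_isOutward] with l hl hin i hi
  have hlow : c ≤ ‖1 - flow (X l) i - edgeEta (X l) i‖ := by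
    refine le_trans ?_ (Complex.re_le_norm _)
    rw [Complex.sub_re, Complex.sub_re, Complex.one_re]
    linarith [hl i hi, S.re_flow_le (hin i hi)]
  rw [div_mul_eq_mul_div, le_div_iff₀ hc]
  exact (mul_le_mul_of_nonneg_left hlow (norm_nonneg _)).trans (S.norm_defect_mul_le l i)

theorem tendsto_edgeSum_defect :
    Tendsto (fun d => edgeSum d fun l i => flow (X l) i - edgeEta (X l) i) atTop (𝓝 0) := by
  obtain ⟨C, hC⟩ := S.exists_norm_defect_le
  obtain ⟨R, hR⟩ := eventually_cofinite_iff_length.1 hC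
  have hzero := S.summable_edgeSum_edgeWeight.tendsto_atTop_zero.const_mul C
  rw [mul_zero] at hzero
  refine squeeze_zero_norm' (eventually_atTop.2 ⟨R, fun d hd => ?_⟩) hzero
  refine (norm_edgeSum_le _ _).trans ?_
  rw [← edgeSum_mul_left]
  exact edgeSum_le fun l i hl hi => hR l (hl ▸ hd) i hi

theorem tsum_baseSum :
    ∑' v : ReducedWord ι, baseSum X v.1 = 1 + μ * ∑' v : ReducedWord ι, (∏ k, X v.1 k)⁻¹ := by
  have hbase := (tendsto_sum_sphere S.summable_baseSum.hasSum).comp (tendsto_add_atTop_nat 1)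
  have hprod := ((tendsto_sum_sphere (f := fun l => (∏ k, X l k)⁻¹)
    S.summable_inv_prod.hasSum).comp (tendsto_add_atTop_nat 1)).const_mul μ |>.const_add 1
  have hdefect := S.tendsto_edgeSum_defect
  simp_rw [edgeSum_sub, S.edgeSum_flow, S.edgeSum_edgeEta] at hdefect
  exact (sub_eq_zero.1 (tendsto_nhds_unique (hprod.sub hbase) hdefect)).symm

end BowditchSystem

end EdgeIdentity

/-! ### The vertex sum along a geodesic -/

section GeodesicSum

theorem add_sub_eq_div_leadCoeff_mul {K : Type*} [Field K] {a z u v : K} (hz : z ≠ 0)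
    (hd : z - z⁻¹ ≠ 0) (ha : a ≠ 0) (hu : u ≠ 0) (hv : v ≠ 0)
    (huv : leadCoeff z u v ≠ 0) (hvu : leadCoeff z v u ≠ 0) :
    a⁻¹ * (u * leadCoeff z u v * (z - z⁻¹))⁻¹
      + (a⁻¹ * (v * leadCoeff z v u * (z - z⁻¹))⁻¹ - (u * v * a)⁻¹)
      = (z - z⁻¹) / a / (leadCoeff z u v * leadCoeff z v u * (z - z⁻¹) ^ 2 * z) := by
  have hA : leadCoeff z u v * (z - z⁻¹) = v - u * z⁻¹ := div_mul_cancel₀ _ hd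
  have hB : leadCoeff z v u * (z - z⁻¹) = u - v * z⁻¹ := div_mul_cancel₀ _ hd
  have hA0 := mul_ne_zero huv hd
  have hB0 := mul_ne_zero hvu hd
  have hprod : leadCoeff z u v * leadCoeff z v u * (z - z⁻¹) ^ 2 * z
      = (v - u * z⁻¹) * (u - v * z⁻¹) * z := by
    rw [← hA, ← hB]
    ring
  rw [hprod, mul_assoc u, mul_assoc v, hA, hB]
  rw [hA] at hA0
  rw [hB] at hB0
  have hzw := mul_inv_cancel₀ hz
  generalize z⁻¹ = w at *
  have hnum : v * (u - v * w) * z + u * (v - u * w) * z - (v - u * w) * (u - v * w) * z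
      = (z - w) * (u * v) := by
    linear_combination (-u * v * w) * hzw
  field_simp
  linear_combination hnum

variable {ι : Type*}

theorem altWord_injective (i j : ι) (b : List ι) : Function.Injective (altWord i j b) := by
  intro m m' h
  have hlen := congrArg List.length h
  rwa [length_altWord, length_altWord, Nat.add_left_cancel_iff] at hlen

theorem altWord_ne_altWord_swap {i j : ι} (hij : i ≠ j) (b : List ι) (m m' : ℕ) :
    altWord i j b m ≠ altWord j i b (m' + 1) := by
  intro h
  have hlen := congrArg List.length h
  rw [length_altWord, length_altWord, Nat.add_left_cancel_iff] at hlen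
  subst hlen
  have hhead : altColour i j m' = altColour j i m' := List.head_eq_of_cons_eq h
  unfold altColour at hhead
  split_ifs at hhead
  exacts [hij hhead, hij hhead.symm]

variable [DecidableEq ι]

/-- The vertices of the geodesic with colours `i`, `j` and base vertex `b`: one ray starts at `b`
with the colour `i`, the other one at the neighbour of `b` along the colour `j`. -/
def geodesicEquiv {i j : ι} (hij : i ≠ j) {b : List ι} (hb : IsBase {i, j} b) :
    ℕ ⊕ ℕ ≃ {v : ReducedWord ι // strip {i, j} v.1 = b} :=
  Equiv.ofBijective
    (Sum.elim
      (fun m => ⟨⟨altWord i j b m, isReducedWord_altWord hij hb.left m⟩, strip_altWord hb m⟩)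
      (fun m => ⟨⟨altWord j i b (m + 1), isReducedWord_altWord hij.symm hb.right (m + 1)⟩, by
        rw [Finset.pair_comm]
        exact strip_altWord hb.symm (m + 1)⟩)) <| by
    constructor
    · rintro (m | m) (m' | m') h <;> simp only [Sum.elim_inl, Sum.elim_inr, Subtype.mk.injEq] at h
      · rw [altWord_injective i j b h]
      · exact absurd h (altWord_ne_altWord_swap hij b m m')
      · exact absurd h.symm (altWord_ne_altWord_swap hij b m' m)
      · rw [Nat.succ_injective (altWord_injective j i b h)]
    · rintro ⟨⟨l, hl⟩, rfl⟩
      obtain ⟨m, hm | hm⟩ := exists_eq_altWord i j hl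
      · exact ⟨Sum.inl m, Subtype.ext (Subtype.ext hm.symm)⟩
      · cases m with
        | zero => exact ⟨Sum.inl 0, Subtype.ext (Subtype.ext hm.symm)⟩
        | succ m => exact ⟨Sum.inr m, Subtype.ext (Subtype.ext hm.symm)⟩

variable [Fintype ι] {μ : ℂ} {X : List ι → ι → ℂ}

theorem HurwitzSystem.prod_altWord (S : HurwitzSystem μ X) {i j : ι} (hij : i ≠ j) (b : List ι)
    (m : ℕ) : ∏ k, X (altWord i j b m) k
      = pairProd (X b) i j * (geodesicSeq X i j b m * geodesicSeq X i j b (m + 1)) := by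
  rw [prod_eq_mul_coProd _ (altColour i j m), S.coProd_altWord hij, mul_left_comm]
  rfl

namespace BowditchSystem

variable (S : BowditchSystem μ X)

include S

theorem hasSum_inv_prod_altWord {i j : ι} (hij : i ≠ j) {b : List ι}
    (hi : IsReducedWord (i :: b)) {z : ℂ} (hz : 1 < ‖z‖) (hzP : z + z⁻¹ = pairProd (X b) i j) :
    HasSum (fun m => (∏ k, X (altWord i j b m) k)⁻¹)
      ((pairProd (X b) i j)⁻¹ * (X b i * leadCoeff z (X b i) (X b j) * (z - z⁻¹))⁻¹) := by
  have hsum : Summable fun m => (∏ k, X (altWord i j b m) k)⁻¹ :=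
    S.summable_inv_prod.comp_injective
      (i := fun m => (⟨altWord i j b m, isReducedWord_altWord hij hi m⟩ : ReducedWord ι))
      fun _ _ h => altWord_injective i j b (congrArg Subtype.val h)
  simp_rw [S.prod_altWord hij, mul_inv (pairProd (X b) i j)] at hsum ⊢
  rw [← geodesicSeq_zero (X := X) i j b, ← S.geodesicSeq_one hij b]
  have hrec := S.geodesicSeq_recurrence hij b
  refine (hasSum_inv_mul_succ (y := geodesicSeq X i j b) hz (hzP ▸ hrec) ?_
    (fun m => S.ne_zero _ _) ?_).mul_left _
  · rw [geodesicSeq_zero, S.geodesicSeq_one hij]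
    exact S.leadCoeff_ne_zero hij hi.tail hz hzP
  · exact (summable_mul_left_iff (inv_ne_zero (S.pairProd_ne_zero hij b))).1 hsum

theorem hasSum_geodesic {i j : ι} (hij : i ≠ j) {b : List ι} (hb : IsBase {i, j} b) :
    HasSum (fun v : {v : ReducedWord ι // strip {i, j} v.1 = b} => (∏ k, X v.1.1 k)⁻¹)
      ((1 - 4 / pairProd (X b) i j ^ 2) ^ (1 / 2 : ℂ) / (pairSq (X b) i j - μ)) := by
  obtain ⟨z, hz, hzP⟩ := (S.isLoxodromic_pairProd b i j hij).exists_one_lt_norm_add_inv_eq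
  have hzP' : z + z⁻¹ = pairProd (X b) j i := by rw [hzP, pairProd_comm]
  have hz0 := ne_zero_of_one_lt_norm hz
  have hd := sub_inv_ne_zero hz
  have hprod : ∏ k, X b k = X b i * X b j * pairProd (X b) i j := by
    rw [prod_eq_mul_coProd (X b) i, coProd_eq_mul_pairProd _ hij, mul_assoc]
  have hleft := S.hasSum_inv_prod_altWord hij hb.left hz hzP
  have hright := (hasSum_nat_add_iff' 1).2 (S.hasSum_inv_prod_altWord hij.symm hb.right hz hzP')
  rw [Finset.sum_range_one, altWord_zero, hprod, pairProd_comm (X b) j i] at hright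
  have hlead := leadCoeff_mul_leadCoeff hz0 hd (X b i) (X b j)
  rw [hzP, S.vertex_pair hij, neg_sub] at hlead
  have hsqrt := sqrt_one_sub_eq hz
  rw [hzP] at hsqrt
  rw [hsqrt, ← hlead, ← add_sub_eq_div_leadCoeff_mul hz0 hd (S.pairProd_ne_zero hij b)
    (S.ne_zero b i) (S.ne_zero b j) (S.leadCoeff_ne_zero hij hb.left.tail hz hzP)
    (S.leadCoeff_ne_zero hij.symm hb.left.tail hz hzP'), ← (geodesicEquiv hij hb).hasSum_iff]
  exact HasSum.sum hleft hright

end BowditchSystem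

end GeodesicSum

section BaseVertices

variable {ι : Type*} [Fintype ι] [DecidableEq ι]

/-- The regular subtrees with colour set `I`, represented by their vertices closest to the root. -/
abbrev BaseVertex (I : Finset ι) : Type _ := {v : ReducedWord ι // IsBase I v.1}

/-- The base vertex of the regular subtree with colour set `I` through a given vertex. -/
def ReducedWord.base (I : Finset ι) (v : ReducedWord ι) : BaseVertex I :=
  ⟨⟨strip I v.1, isReducedWord_strip v.2⟩, isBase_strip v.2⟩

theorem offDiag_childColours (l : List ι) [DecidablePred fun p : ι × ι => IsBase {p.1, p.2} l] :
    (childColours l).offDiag = {p ∈ (Finset.univ : Finset ι).offDiag | IsBase {p.1, p.2} l} := by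
  ext p
  simp only [Finset.mem_offDiag, Finset.mem_filter, mem_childColours, isBase_pair, Finset.mem_univ]
  tauto

namespace BowditchSystem

variable {μ : ℂ} {X : List ι → ι → ℂ} (S : BowditchSystem μ X)

include S

theorem hasSum_sqrt_div {i j : ι} (hij : i ≠ j) :
    HasSum (fun b : BaseVertex {i, j} =>
        (1 - 4 / pairProd (X b.1.1) i j ^ 2) ^ (1 / 2 : ℂ) / (pairSq (X b.1.1) i j - μ))
      (∑' v : ReducedWord ι, (∏ k, X v.1 k)⁻¹) := by
  have hsum := (Equiv.sigmaFiberEquiv (ReducedWord.base {i, j})).hasSum_iff.2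
    S.summable_inv_prod.hasSum
  refine hsum.sigma fun b => ?_
  have hfibre : ∀ v : ReducedWord ι, v.base {i, j} = b ↔ strip {i, j} v.1 = b.1.1 := fun v => by
    rw [Subtype.ext_iff, Subtype.ext_iff, ReducedWord.base]
  exact (Equiv.subtypeEquivRight hfibre).hasSum_iff.2 (S.hasSum_geodesic hij b.2)

theorem summable_eta {i j : ι} (hij : i ≠ j) :
    Summable fun b : BaseVertex {i, j} => eta (pairProd (X b.1.1) i j) := by
  refine (S.summable_sum_norm_eta.comp_injective Subtype.val_injective).of_norm_bounded fun b => ?_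
  have hmem : (i, j) ∈ (childColours b.1.1).offDiag := Finset.mem_offDiag.2
    ⟨mem_childColours.2 b.2.left, mem_childColours.2 b.2.right, hij⟩
  have hle := Finset.single_le_sum (f := fun p : ι × ι => ‖eta (pairProd (X b.1.1) p.1 p.2)‖)
    (fun _ _ => norm_nonneg _) hmem
  exact hle

theorem sum_tsum_eta :
    ∑ p ∈ (Finset.univ : Finset ι).offDiag,
        ∑' b : BaseVertex {p.1, p.2}, eta (pairProd (X b.1.1) p.1 p.2)
      = 1 + μ * ∑' v : ReducedWord ι, (∏ k, X v.1 k)⁻¹ := by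
  classical
  rw [← S.tsum_baseSum]
  let e (p : ι × ι) : ReducedWord ι → ℂ :=
    Set.indicator {v | IsBase {p.1, p.2} v.1} fun v => eta (pairProd (X v.1) p.1 p.2)
  have he : ∀ p ∈ (Finset.univ : Finset ι).offDiag, Summable (e p) := fun p hp =>
    summable_subtype_iff_indicator.1 (S.summable_eta (Finset.mem_offDiag.1 hp).2.2)
  calc ∑ p ∈ (Finset.univ : Finset ι).offDiag,
        ∑' b : BaseVertex {p.1, p.2}, eta (pairProd (X b.1.1) p.1 p.2)
      = ∑ p ∈ (Finset.univ : Finset ι).offDiag, ∑' v, e p v :=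
        Finset.sum_congr rfl fun p _ => tsum_subtype {v : ReducedWord ι | IsBase {p.1, p.2} v.1}
          fun v => eta (pairProd (X v.1) p.1 p.2)
    _ = ∑' v, ∑ p ∈ (Finset.univ : Finset ι).offDiag, e p v := (Summable.tsum_finsetSum he).symm
    _ = ∑' v : ReducedWord ι, baseSum X v.1 := by
        refine tsum_congr fun v => ?_
        rw [baseSum, offDiag_childColours, Finset.sum_filter]
        rfl

end BowditchSystem

end BaseVertices

/-! ### Reduced words and the Cayley tree -/

section CayleyTree

variable {n : ℕ}

/-- The vertex of the Cayley tree that a word stands for; the head of the word is the last letter of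
the product. -/
def toGam : List (Fin n) → Gam n
  | [] => 1
  | i :: l => toGam l * gen i

theorem toGam_cons (i : Fin n) (l : List (Fin n)) : toGam (i :: l) = toGam l * gen i := rfl

theorem toGam_eq_prod (l : List (Fin n)) : toGam l = (l.reverse.map gen).prod := by
  induction l with
  | nil => rfl
  | cons i l ih =>
    rw [toGam_cons, ih, List.reverse_cons, List.map_append, List.prod_append, List.map_singleton,
      List.prod_singleton]

theorem ofAdd_one_ne_one : Multiplicative.ofAdd (1 : ZMod 2) ≠ 1 := by decide

theorem eq_ofAdd_one_of_ne_one {m : Multiplicative (ZMod 2)} (h : m ≠ 1) :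
    m = Multiplicative.ofAdd 1 := by
  revert m
  decide

/-- Reduced words correspond to the normal forms `Monoid.CoprodI.Word` in the free product. -/
def reducedWordEquiv (n : ℕ) :
    ReducedWord (Fin n) ≃ Monoid.CoprodI.Word fun _ : Fin n => Multiplicative (ZMod 2) where
  toFun v :=
    { toList := v.1.reverse.map fun i => ⟨i, Multiplicative.ofAdd 1⟩
      ne_one := by
        intro x hx
        obtain ⟨i, -, rfl⟩ := List.mem_map.1 hx
        exact ofAdd_one_ne_one
      chain_ne := by
        rw [List.isChain_map, List.isChain_reverse]
        exact v.2.imp fun _ _ h => h.symm }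
  invFun w := ⟨(w.toList.map Sigma.fst).reverse, by
    rw [IsReducedWord, List.isChain_reverse, List.isChain_map]
    exact w.chain_ne.imp fun _ _ h => h.symm⟩
  left_inv v := Subtype.ext <| by
    simp only [List.map_map, Function.comp_def, List.map_id', List.reverse_reverse]
  right_inv w := Monoid.CoprodI.Word.ext <| by
    simp only [List.reverse_reverse, List.map_map]
    refine (List.map_congr_left fun x hx => ?_).trans (List.map_id _)
    rw [Function.comp_apply, ← eq_ofAdd_one_of_ne_one (w.ne_one x hx), id]

/-- The reduced words are in bijection with the vertices of the Cayley tree. -/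
def vertexEquiv (n : ℕ) : ReducedWord (Fin n) ≃ Gam n :=
  (reducedWordEquiv n).trans Monoid.CoprodI.Word.equiv.symm

theorem vertexEquiv_apply (v : ReducedWord (Fin n)) : vertexEquiv n v = toGam v.1 := by
  rw [toGam_eq_prod]
  change List.prod (List.map _ (List.map _ _)) = _
  rw [List.map_map]
  rfl

theorem strip_vertexEquiv_symm_mul_gen {I : Finset (Fin n)} {i : Fin n} (hi : i ∈ I) (g : Gam n) :
    strip I ((vertexEquiv n).symm (g * gen i)).1 = strip I ((vertexEquiv n).symm g).1 := by
  obtain ⟨⟨l, hl⟩, rfl⟩ := (vertexEquiv n).surjective g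
  rw [Equiv.symm_apply_apply, vertexEquiv_apply]
  by_cases h : IsReducedWord (i :: l)
  · rw [← toGam_cons, ← vertexEquiv_apply ⟨i :: l, h⟩, Equiv.symm_apply_apply,
      strip_cons_of_mem hi]
  · cases l with
    | nil => exact absurd (List.isChain_singleton i) h
    | cons k l =>
      obtain rfl : i = k := by
        by_contra hne
        exact h (isReducedWord_cons_cons.2 ⟨hne, hl⟩)
      rw [toGam_cons, mul_assoc, gen_mul_gen, mul_one, ← vertexEquiv_apply ⟨l, hl.tail⟩,
        Equiv.symm_apply_apply, strip_cons_of_mem hi]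

theorem treeAt_mul_gen {I : Finset (Fin n)} {i : Fin n} (hi : i ∈ I) (g : Gam n) :
    treeAt (g * gen i) I = treeAt g I :=
  (SimpleGraph.ConnectedComponent.sound
    (SimpleGraph.Adj.reachable (G := colourGraph I) ⟨i, hi, rfl⟩)).symm

theorem treeAt_strip (I : Finset (Fin n)) (l : List (Fin n)) :
    treeAt (toGam (strip I l)) I = treeAt (toGam l) I := by
  induction l with
  | nil => rfl
  | cons k l ih =>
    by_cases hk : k ∈ I
    · rw [strip_cons_of_mem hk, ih, toGam_cons, treeAt_mul_gen hk]
    · rw [strip_cons_of_notMem hk]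

theorem strip_eq_of_treeAt_eq {I : Finset (Fin n)} {g h : Gam n} (hgh : treeAt g I = treeAt h I) :
    strip I ((vertexEquiv n).symm g).1 = strip I ((vertexEquiv n).symm h).1 := by
  have hreach : (colourGraph I).Reachable g h := SimpleGraph.ConnectedComponent.exact hgh
  rw [SimpleGraph.reachable_iff_reflTransGen] at hreach
  clear hgh
  induction hreach with
  | refl => rfl
  | tail _ hadj ih =>
    obtain ⟨i, hi, rfl⟩ := hadj
    rw [ih, strip_vertexEquiv_symm_mul_gen hi]

/-- The regular subtrees with colour set `I` are in bijection with their base vertices. -/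
def treeEquiv (I : Finset (Fin n)) : BaseVertex I ≃ RegTree I :=
  Equiv.ofBijective (fun v => treeAt (toGam v.1.1) I) <| by
    constructor
    · intro v w h
      have hstrip := strip_eq_of_treeAt_eq h
      rw [← vertexEquiv_apply, ← vertexEquiv_apply, Equiv.symm_apply_apply, Equiv.symm_apply_apply,
        v.2.strip_eq, w.2.strip_eq] at hstrip
      exact Subtype.ext (Subtype.ext hstrip)
    · intro T
      obtain ⟨g, rfl⟩ := Quot.exists_rep T
      obtain ⟨v, rfl⟩ := (vertexEquiv n).surjective g
      exact ⟨v.base I, (treeAt_strip I v.1).trans (by rw [vertexEquiv_apply]; rfl)⟩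

theorem treeEquiv_apply {I : Finset (Fin n)} (v : BaseVertex I) :
    treeEquiv I v = treeAt (toGam v.1.1) I := rfl

namespace HurwitzMap

/-- The coordinates of a Hurwitz map at the vertex of a word. -/
def coords (φ : HurwitzMap n) (l : List (Fin n)) (k : Fin n) : ℂ := φ.val k (treeAt (toGam l) {k}ᶜ)

theorem ext_treeAt (φ : HurwitzMap n) (p : ColourPair n) (l : List (Fin n)) :
    φ.ext (p := p) (treeAt (toGam l) p.colours) = pairProd (φ.coords l) p.1.1 p.1.2 :=
  (Finset.prod_subtype (p := (· ∉ p.colours)) _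
    (fun _ => Finset.mem_compl) (φ.coords l)).symm

theorem sqSum_treeAt (φ : HurwitzMap n) (p : ColourPair n) (l : List (Fin n)) :
    φ.sqSum (p := p) (treeAt (toGam l) p.colours) = pairSq (φ.coords l) p.1.1 p.1.2 :=
  (Finset.sum_subtype (p := (· ∉ p.colours)) _
    (fun _ => Finset.mem_compl) fun k => φ.coords l k ^ 2).symm

theorem summand_treeAt (φ : HurwitzMap n) (μ q : ℂ) (p : ColourPair n) (l : List (Fin n)) :
    φ.summand μ q (p := p) (treeAt (toGam l) p.colours)
      = 2 * eta (pairProd (φ.coords l) p.1.1 p.1.2) - q * μ *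
        ((1 - 4 / pairProd (φ.coords l) p.1.1 p.1.2 ^ 2) ^ (1 / 2 : ℂ)
          / (pairSq (φ.coords l) p.1.1 p.1.2 - μ)) := by
  rw [summand, eta, ext_treeAt, sqSum_treeAt]
  ring

theorem hurwitzSystem_coords {μ : ℂ} {φ : HurwitzMap n} (hφ : φ.IsMu μ) :
    HurwitzSystem μ φ.coords where
  of_ne l i k h := by
    rw [coords, coords, toGam_cons, treeAt_mul_gen (by simpa using h.symm)]
  edge l i := φ.edge_rel (toGam l) i
  vertex l := hφ (toGam l)

theorem isLoxodromic_pairProd {μ : ℂ} {φ : HurwitzMap n} (hφ : φ ∈ Bowditch n μ) (l : List (Fin n))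
    {i j : Fin n} (hij : i ≠ j) : IsLoxodromic (pairProd (φ.coords l) i j) := by
  wlog hlt : i < j generalizing i j
  · rw [pairProd_comm]
    exact this hij.symm (hij.lt_or_gt.resolve_left hlt)
  intro t ht h
  exact hφ.2.1 ⟨⟨(i, j), hlt⟩, treeAt (toGam l) _⟩ ⟨t, ht, (φ.ext_treeAt ⟨(i, j), hlt⟩ l).trans h⟩

theorem exists_bound {μ : ℂ} {φ : HurwitzMap n} (hφ : φ ∈ Bowditch n μ) :
    ∃ K : ℝ, 2 < K ∧ ∀ᶠ l in cofinite, ∀ i j, i ≠ j → IsBase {i, j} l →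
      K < ‖pairProd (φ.coords l) i j‖ := by
  obtain ⟨K, hK, hfin⟩ := hφ.2.2
  refine ⟨K, hK, ?_⟩
  have hbase := hfin.image fun γ : AltGeodesic n => ((treeEquiv γ.1.colours).symm γ.2).1.1
  filter_upwards [hbase.compl_mem_cofinite] with l hl i j hij hb
  wlog hlt : i < j generalizing i j
  · rw [pairProd_comm]
    exact this j i hij.symm hb.symm (hij.lt_or_gt.resolve_left hlt)
  let p : ColourPair n := ⟨(i, j), hlt⟩
  let v : BaseVertex p.colours := ⟨⟨l, hb.left.tail⟩, hb⟩
  refine lt_of_not_ge fun hle => hl ⟨⟨p, treeEquiv p.colours v⟩, ?_, ?_⟩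
  · exact (congrArg norm (φ.ext_treeAt p l)).trans_le hle
  · exact congrArg (fun v : BaseVertex p.colours => v.1.1) (Equiv.symm_apply_apply _ v)

theorem three_le_of_mem_bowditch {μ : ℂ} {φ : HurwitzMap n} (hφ : φ ∈ Bowditch n μ) (hn : 2 ≤ n) :
    3 ≤ n := by
  refine lt_of_le_of_ne hn ?_
  rintro rfl
  refine isLoxodromic_pairProd hφ [] (zero_ne_one (α := Fin 2)) 1 (by norm_num) ?_
  rw [pairProd, show ({0, 1} : Finset (Fin 2))ᶜ = ∅ from rfl, Finset.prod_empty, Complex.ofReal_one]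

theorem bowditchSystem {μ : ℂ} {φ : HurwitzMap n} (hφ : φ ∈ Bowditch n μ) (hn : 2 ≤ n) :
    BowditchSystem μ φ.coords where
  toHurwitzSystem := hurwitzSystem_coords hφ.1
  three_le := by
    rw [Fintype.card_fin]
    exact three_le_of_mem_bowditch hφ hn
  isLoxodromic_pairProd l _ _ hij := isLoxodromic_pairProd hφ l hij
  exists_bound := exists_bound hφ

end HurwitzMap

end CayleyTree

/-! ### The identity -/

section Identity

variable {n : ℕ}

theorem ColourPair.two_le (p : ColourPair n) : 2 ≤ n := by
  have := p.2
  omega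

theorem sum_offDiag_eq_two_mul_sum_colourPair {R : Type*} [NonAssocSemiring R]
    {f : Fin n → Fin n → R} (hf : ∀ i j, f i j = f j i) :
    ∑ p ∈ (Finset.univ : Finset (Fin n)).offDiag, f p.1 p.2
      = 2 * ∑ p : ColourPair n, f p.1.1 p.1.2 := by
  have hlt : ∑ p : ColourPair n, f p.1.1 p.1.2 = ∑ p : Fin n × Fin n with p.1 < p.2, f p.1 p.2 :=
    (Finset.sum_subtype _ (by simp) fun p : Fin n × Fin n => f p.1 p.2).symm
  have hgt : ∑ p : Fin n × Fin n with p.2 < p.1, f p.1 p.2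
      = ∑ p : Fin n × Fin n with p.1 < p.2, f p.1 p.2 :=
    Finset.sum_equiv (Equiv.prodComm _ _) (by simp) fun p _ => hf p.1 p.2
  have hunion : (Finset.univ : Finset (Fin n)).offDiag
      = Finset.univ.filter (fun p => p.1 < p.2) ∪ Finset.univ.filter (fun p => p.2 < p.1) := by
    ext p
    simp
  rw [hunion, Finset.sum_union, hgt, hlt, two_mul]
  exact Finset.disjoint_filter.2 fun p _ => lt_asymm

namespace HurwitzMap

variable {μ : ℂ} {φ : HurwitzMap n}

theorem tsum_inv_prod_coords (φ : HurwitzMap n) :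
    ∑' v : ReducedWord (Fin n), (∏ k, φ.coords v.1 k)⁻¹
      = ∑' g : Gam n, (∏ k, φ.val k (treeAt g {k}ᶜ))⁻¹ := by
  rw [← (vertexEquiv n).tsum_eq]
  simp only [vertexEquiv_apply, coords]

theorem hasSum_summand (hφ : φ ∈ Bowditch n μ) (hn : 2 ≤ n) (q : ℂ) (p : ColourPair n) :
    HasSum (fun γ : AltGeodesicOf p => φ.summand μ q γ)
      (2 * ∑' b : BaseVertex p.colours, eta (pairProd (φ.coords b.1.1) p.1.1 p.1.2)
        - q * μ * ∑' g : Gam n, (∏ k, φ.val k (treeAt g {k}ᶜ))⁻¹) := by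
  have S := bowditchSystem hφ hn
  have hsum := ((S.summable_eta p.2.ne).hasSum.mul_left 2).sub
    ((S.hasSum_sqrt_div p.2.ne).mul_left (q * μ))
  rw [tsum_inv_prod_coords] at hsum
  rw [← (treeEquiv p.colours).hasSum_iff]
  exact hsum.congr_fun fun b => φ.summand_treeAt μ q p b.1.1

theorem two_mul_sum_tsum_eta (hφ : φ ∈ Bowditch n μ) (hn : 2 ≤ n) :
    2 * ∑ p : ColourPair n,
        ∑' b : BaseVertex p.colours, eta (pairProd (φ.coords b.1.1) p.1.1 p.1.2)
      = 1 + μ * ∑' g : Gam n, (∏ k, φ.val k (treeAt g {k}ᶜ))⁻¹ := by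
  rw [← tsum_inv_prod_coords, ← (bowditchSystem hφ hn).sum_tsum_eta]
  refine (sum_offDiag_eq_two_mul_sum_colourPair
    (f := fun i j => ∑' b : BaseVertex {i, j}, eta (pairProd (φ.coords b.1.1) i j))
    fun i j => ?_).symm
  simp only [pairProd_comm _ i j]
  rw [Finset.pair_comm]

theorem ext_ne_zero_and_sqSum_ne (hφ : φ ∈ Bowditch n μ) (hn : 2 ≤ n) {p : ColourPair n}
    (γ : AltGeodesicOf p) : φ.ext γ ≠ 0 ∧ φ.sqSum γ ≠ μ := by
  have S := bowditchSystem hφ hn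
  obtain ⟨b, rfl⟩ := (treeEquiv p.colours).surjective γ
  rw [treeEquiv_apply, ext_treeAt, sqSum_treeAt]
  exact ⟨S.pairProd_ne_zero p.2.ne _, S.pairSq_ne p.2.ne b.1.2⟩

theorem summable_inv_prod (hφ : φ ∈ Bowditch n μ) (hn : 2 ≤ n) :
    Summable fun g : Gam n => (∏ k, φ.val k (treeAt g {k}ᶜ))⁻¹ := by
  rw [← (vertexEquiv n).summable_iff]
  exact (bowditchSystem hφ hn).summable_inv_prod.congr fun v => by
    rw [Function.comp_apply, vertexEquiv_apply]
    rfl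

end HurwitzMap

end Identity

end MarkoffHurwitz

end

open MarkoffHurwitz in
theorem theorem4p4_general {n : ℕ} {μ : ℂ} {φ : HurwitzMap n} (hφ : φ ∈ Bowditch n μ) (hn : 2 ≤ n)
    (q : ColourPair n → ℂ) :
    (∀ (p : ColourPair n) (γ : AltGeodesicOf p), φ.ext γ ≠ 0 ∧ φ.sqSum γ ≠ μ) ∧
    (∀ p : ColourPair n, Summable fun γ : AltGeodesicOf p => ‖φ.summand μ (q p) γ‖) ∧
    (Summable fun g : Gam n => ‖(∏ k, φ.val k (treeAt g {k}ᶜ))⁻¹‖) ∧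
    ∑ p : ColourPair n, ∑' γ : AltGeodesicOf p, φ.summand μ (q p) γ
      = 1 + (1 - ∑ p, q p) * μ * ∑' g : Gam n, (∏ k, φ.val k (treeAt g {k}ᶜ))⁻¹ := by
  have hsum := fun p => HurwitzMap.hasSum_summand hφ hn (q p) p
  refine ⟨fun _ => HurwitzMap.ext_ne_zero_and_sqSum_ne hφ hn, fun p => (hsum p).summable.norm,
    (HurwitzMap.summable_inv_prod hφ hn).norm, ?_⟩
  simp_rw [fun p => (hsum p).tsum_eq]
  rw [Finset.sum_sub_distrib, ← Finset.mul_sum, ← Finset.sum_mul, ← Finset.sum_mul,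
    HurwitzMap.two_mul_sum_tsum_eta hφ hn]
  ring

theorem theorem4p4 (n : ℕ) (μ : ℂ) (φ : MarkoffHurwitz.HurwitzMap n)
    (hφ : φ ∈ MarkoffHurwitz.Bowditch n μ)
    (q : MarkoffHurwitz.ColourPair n → ℂ)
    (hq : ∑ p : MarkoffHurwitz.ColourPair n, q p = 1) :
    (∀ (p : MarkoffHurwitz.ColourPair n) (γ : MarkoffHurwitz.AltGeodesicOf p),
        φ.ext γ ≠ 0 ∧ φ.sqSum γ ≠ μ) ∧
    (∀ p : MarkoffHurwitz.ColourPair n,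
        Summable fun γ : MarkoffHurwitz.AltGeodesicOf p => ‖φ.summand μ (q p) γ‖) ∧
    ∑ p : MarkoffHurwitz.ColourPair n,
        ∑' γ : MarkoffHurwitz.AltGeodesicOf p, φ.summand μ (q p) γ = 1 := by
  obtain ⟨p, -, -⟩ := Finset.exists_ne_zero_of_sum_ne_zero (hq.trans_ne one_ne_zero)
  obtain ⟨hne, hs, -, hsum⟩ := theorem4p4_general hφ p.two_le q
  exact ⟨hne, hs, by rw [hsum, hq, sub_self, zero_mul, zero_mul, add_zero]⟩
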